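/- Let $\zeta_1,\dots,\zeta_L$ ($L\ge 1$) be an orthonormal basis of the Euclidean space $\mathbb{R}^d$ and let $0<\mu_l\le 1$. For $w=\sum_l\alpha_l\zeta_l$ put $A(w)=\sum_l\lambda_l(w)\,\zeta_l\zeta_l^\top$ with $\lambda_l(w)=\mu_l\alpha_l$. A flow $\dot w=g(w)$, $\|w\|_2\le 1$, is understood as the projected flow on the closed unit ball: the velocity is $g(w)$, with its outward radial part removed on the unit sphere (right derivatives). Let $a>1$. The nodes $j=0,1,2,\dots$ have initial coefficients $\alpha_{j,l}$, independent over all $j,l$, with $\Pr[\alpha_{j,l}\le x]=\exp(-x^{-a})$ for $x>0$; node $j$ starts at the nearest point of the unit ball to $\sum_l\alpha_{j,l}\zeta_l$. For a sequence of trajectories, the expected number of nodes to get all modes is the expectation of the least $n$ such that every $\zeta_l$ is the limit as $t\to\infty$ of the trajectory of one of the first $n$ nodes. **Independent feature learning.** Let every node follow $\dot w=A(w)w$, $\|w\|_2\le 1$. Then every node converges to $\zeta_l$ with probability $p_l=\mu_l^a/\sum_k\mu_k^a$. The expected number $T_0$ of nodes to get all modes is finite, and $T_0\ge\max\bigl(1/\min_l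 p_l,\ L\sum_{l=1}^L 1/l\bigr)$. **Muon guiding.** The nodes are learned one after the other. When node $j$ is learned, let $S$ be the set of modes to which some earlier node converges. 1. (Muon update.) Let node $j$ follow $\dot w=\hat g$, $\|w\|_2\le 1$, where $\hat g$ is the last column of $UV^\top$, and $UDV^\top$ is the compact singular value decomposition (all diagonal entries of $D$ positive) of the matrix whose columns are $\zeta_s$ ($s\in S$) followed by the gradient $A(w)w$. The expected number $T_a$ of nodes to get all modes satisfies $L\le T_a\le 2^{-a}T_0+(1-2^{-a})L$. 2. (Discount by exactly one half.) If instead node $j$ follows $\dot w=A(w)w$, $\|w\|_2\le 1$, with $\mu_l$ replaced by $\mu_l/2$ exactly for $l\in S$, then the expected number $T_a'$ of nodes to get all modes is $T_a'=2^{-a}T_0+(1-2^{-a})L$. **Large $a$.** For fixed $\mu_1,\dots,\mu_L$, $T_a\to L$ as $a\to\infty$; and $T_a'\to L$ as $a\to\infty$ if $\max_l\mu_l<2\min_l\mu_l$. -/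

import Mathlib

open MeasureTheory ProbabilityTheory Filter Topology
open scoped ENNReal RealInnerProductSpace

noncomputable section

namespace MuonRebalance

/-- The weight space `ℝ^d` with its Euclidean norm. -/
abbrev Weight (d : ℕ) : Type := EuclideanSpace ℝ (Fin d)

/-- A system of orthonormal modes `ζ_1, …, ζ_L`, which is a basis of the weight space. -/
abbrev Modes (L d : ℕ) : Type := OrthonormalBasis (Fin L) ℝ (Weight d)

/-! ### The dynamics on the unit ball -/

/-- `A(w) = ∑_l λ_l(w) ζ_l ζ_lᵀ` with `λ_l(w) = μ_l α_l`, where `α_l = ⟪ζ_l, w⟫`. -/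
def modeOperator {L d : ℕ} (ζ : Modes L d) (μ : Fin L → ℝ) (w : Weight d) :
    Weight d →L[ℝ] Weight d :=
  ∑ l, (μ l * ⟪ζ l, w⟫) • (innerSL ℝ (ζ l)).smulRight (ζ l)

/-- The unconstrained gradient `g = A(w) w`. -/
def modeGradient {L d : ℕ} (ζ : Modes L d) (μ : Fin L → ℝ) (w : Weight d) : Weight d :=
  modeOperator ζ μ w w

/-- The nearest point of the closed unit ball. -/
def ballProj {d : ℕ} (x : Weight d) : Weight d := (max 1 ‖x‖)⁻¹ • x

open Classical in
/-- For `‖w‖ ≤ 1`, the orthogonal projection of `v` onto the tangent cone at `w` of the closed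
unit ball: `v` itself, except that an outward radial part is removed on the unit sphere. -/
def tangentProj {d : ℕ} (w v : Weight d) : Weight d :=
  if ‖w‖ < 1 ∨ ⟪v, w⟫ ≤ 0 then v else v - ⟪v, w⟫ • w

/-- `w : [0, ∞) → ℝ^d` solves `ẇ = g`, `‖w‖ ≤ 1` (projected dynamics on the unit ball), where
`g` is the update that the rule `R` produces at `w`, started from `x₀` (brought into the ball by
the nearest-point projection). The derivative is the right derivative because the velocity jumps
when the trajectory reaches the sphere. -/
structure IsTrajectory {d : ℕ} (R : Weight d → Weight d → Prop) (x₀ : Weight d)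
    (w : ℝ → Weight d) : Prop where
  init : w 0 = ballProj x₀
  cont : ContinuousOn w (Set.Ici 0)
  norm_le : ∀ t, 0 ≤ t → ‖w t‖ ≤ 1
  deriv : ∀ t, 0 ≤ t → ∃ g, R (w t) g ∧
    HasDerivWithinAt w (tangentProj (w t) g) (Set.Ici t) t

/-- The update rule of plain gradient dynamics: `g = A(w) w`. -/
def gradientRule {L d : ℕ} (ζ : Modes L d) (μ : Fin L → ℝ) (w g : Weight d) : Prop :=
  g = modeGradient ζ μ w

/-! ### Muon -/

/-- `O` is the Muon update of `G`: `G = U D Vᵀ` is a (compact) singular value decomposition, i.e.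
`U`, `V` have orthonormal columns and `D` is diagonal with positive entries, and `O = U Vᵀ`. -/
def IsMuonUpdate {m n : Type} [Fintype m] [Fintype n] (G O : Matrix m n ℝ) : Prop :=
  ∃ (r : ℕ) (U : Matrix m (Fin r) ℝ) (V : Matrix n (Fin r) ℝ) (D : Fin r → ℝ),
    U.transpose * U = 1 ∧ V.transpose * V = 1 ∧ (∀ i, 0 < D i) ∧
    G = U * Matrix.diagonal D * V.transpose ∧ O = U * V.transpose

/-- The matrix `[P_S, g]`: its columns are the directions `ζ_s`, `s ∈ S`, already learned
(without repetition), followed by `g`. -/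
def augmented {L d : ℕ} (ζ : Modes L d) (S : Finset (Fin L)) (g : Weight d) :
    Matrix (Fin d) (Option S) ℝ :=
  Matrix.of fun i c => c.elim (g i) (fun s => ζ s i)

/-- The Muon rule for the node that is being learned when the modes in `S` have been collected:
the update is the last column of the Muon update of `[P_S, A(w) w]`. -/
def muonRule {L d : ℕ} (ζ : Modes L d) (μ : Fin L → ℝ) (S : Finset (Fin L))
    (w g : Weight d) : Prop :=
  ∃ O, IsMuonUpdate (augmented ζ S (modeGradient ζ μ w)) O ∧ ∀ i, g i = O i none

/-- The rule in which `μ_l` is divided by `2` exactly for the collected modes `l ∈ S`. -/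
def halvingRule {L d : ℕ} (ζ : Modes L d) (μ : Fin L → ℝ) (S : Finset (Fin L))
    (w g : Weight d) : Prop :=
  gradientRule ζ (fun l => if l ∈ S then μ l / 2 else μ l) w g

/-! ### Many nodes -/

open Classical in
/-- The set of modes to which at least one of the nodes `0, …, n - 1` converges. -/
def collected {L d : ℕ} (ζ : Modes L d) (w : ℕ → ℝ → Weight d) (n : ℕ) : Finset (Fin L) :=
  Finset.univ.filter fun l => ∃ j < n, Tendsto (w j) atTop (𝓝 (ζ l))

/-- The least number of nodes that collect all modes (`⊤` if no number does). -/
def nodesNeeded {L d : ℕ} (ζ : Modes L d) (w : ℕ → ℝ → Weight d) : ℕ∞ :=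
  ⨅ (n : ℕ) (_ : collected ζ w n = Finset.univ), (n : ℕ∞)

/-- The expected number of nodes that collect all modes. -/
def expectedNodes {L d : ℕ} (ζ : Modes L d) {Ω : Type*} [MeasurableSpace Ω] (P : Measure Ω)
    (w : ℕ → Ω → ℝ → Weight d) : ℝ≥0∞ :=
  ∫⁻ ω, ((nodesNeeded ζ fun j => w j ω : ℕ∞) : ℝ≥0∞) ∂P

/-- The coefficients `α_l` of all nodes are independent with `CDF(x) = exp(-x^{-a})`, `x > 0`. -/
structure IsFrechetFamily {L : ℕ} (a : ℝ) {Ω : Type*} [MeasurableSpace Ω] (P : Measure Ω)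
    (α : ℕ → Fin L → Ω → ℝ) : Prop where
  measurable : ∀ j l, Measurable (α j l)
  indep : iIndepFun (fun (i : ℕ × Fin L) => α i.1 i.2) P
  cdf : ∀ j l x, 0 < x → P {ω | α j l ω ≤ x} = ENNReal.ofReal (Real.exp (-x ^ (-a)))

/-- The point `∑_l α_l ζ_l`. -/
def combination {L d : ℕ} (ζ : Modes L d) (α : Fin L → ℝ) : Weight d := ∑ l, α l • ζ l

/-- Independent learning: every node follows the gradient dynamics by itself. -/
def IsIndependentLearning {L d : ℕ} (ζ : Modes L d) (μ : Fin L → ℝ) {Ω : Type*}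
    [MeasurableSpace Ω] (P : Measure Ω) (α : ℕ → Fin L → Ω → ℝ)
    (w : ℕ → Ω → ℝ → Weight d) : Prop :=
  ∀ᵐ ω ∂P, ∀ j, IsTrajectory (gradientRule ζ μ) (combination ζ fun l => α j l ω) (w j ω)

/-- Sequential learning: node `j` follows the rule `R S`, where `S` is the set of the modes
collected by the nodes before it. -/
def IsSequentialLearning {L d : ℕ} (ζ : Modes L d)
    (R : Finset (Fin L) → Weight d → Weight d → Prop) {Ω : Type*} [MeasurableSpace Ω]
    (P : Measure Ω) (α : ℕ → Fin L → Ω → ℝ) (w : ℕ → Ω → ℝ → Weight d) : Prop :=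
  ∀ᵐ ω ∂P, ∀ j, IsTrajectory (R (collected ζ (fun i => w i ω) j))
    (combination ζ fun l => α j l ω) (w j ω)

/-- `p_l = μ_l^a / ∑_k μ_k^a`. -/
def modeProb {L : ℕ} (μ : Fin L → ℝ) (a : ℝ) (l : Fin L) : ℝ := μ l ^ a / ∑ k, μ k ^ a

end MuonRebalance

end

noncomputable section

namespace MuonRebalance


/-! ### Right derivatives and the dominant coordinate of a projected flow -/

/-! In the mode coordinates `y k` every flow reads `y k' = (r k - ρ) * y k`, where the radial
correction `ρ` is common to all modes and cancels in the ratios `y k / y l`. For the gradient flow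
`r k = μ k * y k`, so the mode with the largest `μ k * α k` wins; projection onto the ball only
rescales the coefficients (`tendsto_of_dominant`, `tendsto_of_gradientRule`).

For Muon, the last column of `U Vᵀ` has a closed form (`muon_coord`): up to a common factor,
collected coordinates of the gradient are kept and new ones are multiplied by `1 + 1/h`, where `h`
is the length of the new part of the gradient. As `h` is at most the largest new `μ k * y k`, and `μ
≤ 1`, the dominant new mode outgrows every collected one (`tendsto_of_muonRule`). No node is wasted,
so the Muon expectation is exactly `L`, and its upper bound reduces to `L ≤ T₀`.

A Fréchet variable is `E ^ (-1/a)` with `E` standard exponential, whence the winner has law `p`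
(`measure_isDominant`). Nodes being independent, the collected set is a Markov chain of
coupon-collector type. Any nonnegative solution `W` of its one-step equations gives the expected
time (`hasSum_process_measure`). Halving the collected weights keeps the conditional law of the next
new mode and changes the mean wait from `1/Q` to `2^(-a)/Q + (1 - 2^(-a))`, where `Q` is the missing
mass; this gives the exact formula for `T_a'`. The bounds on `T₀` come from explicit sub- and
supersolutions and the comparison principle `le_of_remaining_le`. -/

theorem le_add_mul_of_rightDeriv_le {f f' : ℝ → ℝ} {a C : ℝ} (hf : ContinuousOn f (Set.Ici a))
    (hf' : ∀ t, a ≤ t → HasDerivWithinAt f (f' t) (Set.Ici t) t)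
    (hC : ∀ t, a ≤ t → f' t ≤ C) {t : ℝ} (ht : a ≤ t) : f t ≤ f a + C * (t - a) := by
  refine image_le_of_deriv_right_le_deriv_boundary (f := f) (f' := f') (a := a) (b := t)
    (B := fun s => f a + C * (s - a)) (B' := fun _ => C)
    (hf.mono Set.Icc_subset_Ici_self) (fun x hx => hf' x hx.1) (by simp) (by fun_prop)
    (fun x hx => ?_) (fun x hx => hC x hx.1) (Set.right_mem_Icc.2 ht)
  simpa using (((hasDerivWithinAt_id x (Set.Ici x)).sub_const a).const_mul C).const_add (f a)

/-- Barrier argument against `y 0 * exp (-(C + 1) t)`; the extra `1` makes the inequality strict at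
a contact point. There `y` is positive, so the bounds on `g` and `ρ` are needed only where `y > 0`.
The Muon flow depends on this, since its update is controlled only while an uncollected coordinate
is nonzero. -/
theorem pos_of_rightDeriv {y g ρ : ℝ → ℝ} {C : ℝ} (h0 : 0 < y 0)
    (hy : ContinuousOn y (Set.Ici 0))
    (hd : ∀ t, 0 ≤ t → HasDerivWithinAt y (g t - ρ t * y t) (Set.Ici t) t)
    (hg : ∀ t, 0 ≤ t → 0 < y t → 0 ≤ g t ∧ ρ t ≤ C) {t : ℝ} (ht : 0 ≤ t) : 0 < y t := by
  have key : -y t ≤ -(y 0 * Real.exp (-(C + 1) * t)) := by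
    refine image_le_of_deriv_right_lt_deriv_boundary (f := fun s => -y s)
      (f' := fun s => -(g s - ρ s * y s)) (a := 0) (b := t)
      (B := fun s => -(y 0 * Real.exp (-(C + 1) * s)))
      (B' := fun s => (C + 1) * (y 0 * Real.exp (-(C + 1) * s)))
      (hy.mono Set.Icc_subset_Ici_self).neg (fun x hx => (hd x hx.1).neg) (by simp)
      (fun x => ?_) (fun x hx he => ?_) (Set.right_mem_Icc.2 ht)
    · have := (((hasDerivAt_id x).const_mul (-(C + 1))).exp.const_mul (y 0)).neg
      exact this.congr_deriv (by simp only [id]; ring)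
    · have he' : y x = y 0 * Real.exp (-(C + 1) * x) := by linarith
      have hp : 0 < y x := by rw [he']; positivity
      obtain ⟨h1, h2⟩ := hg x hx.1 hp
      rw [← he']
      nlinarith [mul_le_mul_of_nonneg_right h2 hp.le]
  have : 0 < y 0 * Real.exp (-(C + 1) * t) := by positivity
  linarith

section Dominance

variable {ι : Type*} {y r : ι → ℝ → ℝ} {ρ : ℝ → ℝ}

theorem hasDerivWithinAt_ratio
    (hpos : ∀ k t, 0 ≤ t → 0 < y k t)
    (hd : ∀ k t, 0 ≤ t → HasDerivWithinAt (y k) ((r k t - ρ t) * y k t) (Set.Ici t) t)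
    (k l : ι) {t : ℝ} (ht : 0 ≤ t) :
    HasDerivWithinAt (fun s => y k s / y l s) ((r k t - r l t) * (y k t / y l t))
      (Set.Ici t) t := by
  have hl := (hpos l t ht).ne'
  refine ((hd k t ht).div (hd l t ht) hl).congr_deriv ?_
  field_simp
  ring

/-- Within the group `G`, where the rates are proportional to `m_k y_k`, the order of the
`m_k y_k` is preserved. -/
theorem weighted_le_of_weighted_lt {k l : ι} {mk ml : ℝ} {s : ℝ → ℝ} (hml : 0 < ml) (hmk : 0 < mk)
    (hcont : ∀ k, ContinuousOn (y k) (Set.Ici 0)) (hpos : ∀ k t, 0 ≤ t → 0 < y k t)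
    (hd : ∀ k t, 0 ≤ t → HasDerivWithinAt (y k) ((r k t - ρ t) * y k t) (Set.Ici t) t)
    (hs : ∀ t, 0 ≤ t → 0 < s t)
    (hrk : ∀ t, 0 ≤ t → r k t = s t * (mk * y k t))
    (hrl : ∀ t, 0 ≤ t → r l t = s t * (ml * y l t))
    (h0 : mk * y k 0 < ml * y l 0) {t : ℝ} (ht : 0 ≤ t) :
    mk * y k t ≤ (mk * y k 0 / (ml * y l 0)) * (ml * y l t) := by
  set θ := y k 0 / y l 0 with hθ
  have hl0 := hpos l 0 le_rfl
  have hk0 := hpos k 0 le_rfl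
  have key : y k t / y l t ≤ θ := by
    refine image_le_of_deriv_right_lt_deriv_boundary (f := fun s => y k s / y l s)
      (f' := fun t => (r k t - r l t) * (y k t / y l t)) (a := 0) (b := t)
      (B := fun _ => θ) (B' := fun _ => 0)
      (((hcont k).div (hcont l) fun x hx => (hpos l x hx).ne').mono Set.Icc_subset_Ici_self)
      (fun x hx => hasDerivWithinAt_ratio hpos hd k l hx.1) le_rfl
      (fun x => hasDerivAt_const x θ) (fun x hx he => ?_) (Set.right_mem_Icc.2 ht)
    -- When the ratio touches its initial value `θ`, the strict inequality `mk * θ < ml` makes its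
    -- derivative negative, so it cannot cross.
    have hlx := hpos l x hx.1
    have hkx := hpos k x hx.1
    refine mul_neg_of_neg_of_pos ?_ (by positivity)
    rw [hrk x hx.1, hrl x hx.1, sub_neg]
    refine mul_lt_mul_of_pos_left ?_ (hs x hx.1)
    have h1 : y k x = θ * y l x := by rw [← he]; field_simp
    have h2 : mk * θ < ml := by
      rw [hθ, ← mul_div_assoc, div_lt_iff₀ hl0]; exact h0
    rw [h1]
    nlinarith
  have hlt := hpos l t ht
  rw [div_le_iff₀ hlt] at key
  calc mk * y k t ≤ mk * (θ * y l t) := by gcongr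
    _ = _ := by rw [hθ]; field_simp

/-- `G` is the group of modes competing at a common speed `s`; modes outside it are only required to
lag behind the leader `l`. The rate gap makes every ratio to `y l` decay exponentially, and `y l`
must then climb to the sphere because nothing holds it back in the interior. -/
theorem tendsto_of_dominant [Fintype ι] [DecidableEq ι] {m : ι → ℝ} {G : Set ι} {s : ℝ → ℝ} {c : ℝ} {l : ι}
    (hm : ∀ k, 0 < m k) (hl : l ∈ G) (hc : 0 < c)
    (hcont : ∀ k, ContinuousOn (y k) (Set.Ici 0)) (hpos : ∀ k t, 0 ≤ t → 0 < y k t)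
    (hle : ∀ t, 0 ≤ t → ∑ k, y k t ^ 2 ≤ 1)
    (hd : ∀ k t, 0 ≤ t → HasDerivWithinAt (y k) ((r k t - ρ t) * y k t) (Set.Ici t) t)
    (hρ0 : ∀ t, 0 ≤ t → ∑ k, y k t ^ 2 < 1 → ρ t = 0)
    (hρ1 : ∀ t, 0 ≤ t → ρ t = 0 ∨ ρ t = ∑ k, r k t * y k t ^ 2)
    (hs : ∀ t, 0 ≤ t → c ≤ s t)
    (hG : ∀ k ∈ G, ∀ t, 0 ≤ t → r k t = s t * (m k * y k t))
    (hGc : ∀ k ∉ G, ∀ t, 0 ≤ t → (∀ j ∈ G, m j * y j t ≤ m l * y l t) →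
      r k t + c * (m l * y l t) ≤ r l t)
    (h0 : ∀ k ∈ G, k ≠ l → m k * y k 0 < m l * y l 0) (k : ι) :
    Tendsto (y k) atTop (𝓝 (if k = l then 1 else 0)) := by
  have hml := hm l
  have hl0 := hpos l 0 le_rfl
  have horder : ∀ j ∈ G, ∀ t, 0 ≤ t → m j * y j t ≤ m l * y l t := by
    intro j hj t ht
    rcases eq_or_ne j l with rfl | hjl
    · exact le_rfl
    have h := weighted_le_of_weighted_lt hml (hm j) hcont hpos hd (fun t ht => hc.trans_le (hs t ht))
      (hG j hj) (hG l hl) (h0 j hj hjl) ht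
    refine h.trans (mul_le_of_le_one_left (mul_pos hml (hpos l t ht)).le ?_)
    exact (div_le_one (by positivity)).2 (h0 j hj hjl).le
  have hrlpos : ∀ t, 0 ≤ t → c * (m l * y l t) ≤ r l t := by
    intro t ht
    rw [hG l hl t ht]
    exact mul_le_mul_of_nonneg_right (hs t ht) (mul_pos hml (hpos l t ht)).le
  have hrle : ∀ j t, 0 ≤ t → r j t ≤ r l t := by
    intro j t ht
    have hylt := mul_pos hml (hpos l t ht)
    by_cases hj : j ∈ G
    · rw [hG l hl t ht, hG j hj t ht]
      exact mul_le_mul_of_nonneg_left (horder j hj t ht) (hc.le.trans (hs t ht))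
    · have := hGc j hj t ht fun i hi => horder i hi t ht
      nlinarith [mul_pos hc hylt]
  -- A nonzero `ρ` sums the rates with weights `y k ^ 2` of total at most one, so it never exceeds
  -- the leading rate; hence `y l` is nondecreasing.
  have hρle : ∀ t, 0 ≤ t → ρ t ≤ r l t := by
    intro t ht
    have h1 : 0 ≤ r l t := (mul_pos hc (mul_pos hml (hpos l t ht))).le.trans (hrlpos t ht)
    rcases hρ1 t ht with h | h
    · rw [h]; exact h1
    · rw [h]
      calc ∑ k, r k t * y k t ^ 2 ≤ ∑ k, r l t * y k t ^ 2 :=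
            Finset.sum_le_sum fun j _ => mul_le_mul_of_nonneg_right (hrle j t ht) (sq_nonneg _)
        _ = r l t * ∑ k, y k t ^ 2 := by rw [Finset.mul_sum]
        _ ≤ r l t * 1 := mul_le_mul_of_nonneg_left (hle t ht) h1
        _ = r l t := mul_one _
  have hmono : ∀ a t, 0 ≤ a → a ≤ t → y l a ≤ y l t := by
    intro a t ha hat
    have := le_add_mul_of_rightDeriv_le (f := fun s => -y l s) (C := 0)
      ((hcont l).mono (Set.Ici_subset_Ici.2 ha)).neg (fun t ht => (hd l t (ha.trans ht)).neg)
      (fun t ht => ?_) hat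
    · simpa using this
    · have := mul_nonneg (sub_nonneg.2 (hρle t (ha.trans ht))) (hpos l t (ha.trans ht)).le
      linarith
  have hyl1 : ∀ j t, 0 ≤ t → y j t ≤ 1 := by
    intro j t ht
    have h1 : y j t ^ 2 ≤ 1 := (Finset.single_le_sum (f := fun k => y k t ^ 2)
      (fun _ _ => sq_nonneg _) (Finset.mem_univ j)).trans (hle t ht)
    nlinarith [hpos j t ht]
  -- all other coordinates tend to zero
  have hzero : ∀ j, j ≠ l → Tendsto (y j) atTop (𝓝 0) := by
    intro j hj
    -- The gap is uniform in time because `y l` stays above its initial value.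
    obtain ⟨δ, hδ, hgap⟩ : ∃ δ > 0, ∀ t, 0 ≤ t → r j t - r l t ≤ -δ := by
      by_cases hjG : j ∈ G
      · have hlt := h0 j hjG hj
        set θ := m j * y j 0 / (m l * y l 0) with hθ
        have hθ1 : θ < 1 := (div_lt_one (by positivity)).2 hlt
        refine ⟨c * ((1 - θ) * (m l * y l 0)), by
          have := sub_pos.2 hθ1
          positivity, fun t ht => ?_⟩
        have h := weighted_le_of_weighted_lt hml (hm j) hcont hpos hd
          (fun t ht => hc.trans_le (hs t ht)) (hG j hjG) (hG l hl) hlt ht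
        rw [← hθ] at h
        rw [hG l hl t ht, hG j hjG t ht]
        have h2 : (1 - θ) * (m l * y l 0) ≤ m l * y l t - m j * y j t := by
          have : (1 - θ) * (m l * y l 0) ≤ (1 - θ) * (m l * y l t) := by
            have := sub_pos.2 hθ1
            have := hmono 0 t le_rfl ht
            gcongr
          linarith
        have h3 : c * ((1 - θ) * (m l * y l 0)) ≤ s t * (m l * y l t - m j * y j t) := by
          have := sub_pos.2 hθ1
          exact mul_le_mul (hs t ht) h2 (by positivity) (hc.le.trans (hs t ht))
        linarith
      · refine ⟨c * (m l * y l 0), by positivity, fun t ht => ?_⟩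
        have h1 := hGc j hjG t ht fun i hi => horder i hi t ht
        have h2 : c * (m l * y l 0) ≤ c * (m l * y l t) := by
          have := hmono 0 t le_rfl ht
          gcongr
        linarith
    have hdecay : ∀ t, 0 ≤ t → y j t ≤ (y j 0 / y l 0) * Real.exp (-(δ * t)) := by
      intro t ht
      have h1 : y j t / y l t * Real.exp (δ * t) ≤ y j 0 / y l 0 := by
        have := le_add_mul_of_rightDeriv_le (a := 0) (C := 0)
          (f := fun s => y j s / y l s * Real.exp (δ * s))
          (f' := fun t => (r j t - r l t) * (y j t / y l t) * Real.exp (δ * t) +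
            y j t / y l t * (Real.exp (δ * t) * δ)) ?_ (fun t ht => ?_) (fun t ht => ?_) ht
        · simpa using this
        · exact ((hcont j).div (hcont l) fun x hx => (hpos l x hx).ne').mul (by fun_prop)
        · refine (hasDerivWithinAt_ratio hpos hd j l ht).mul ?_
          simpa using (((hasDerivAt_id t).const_mul δ).exp).hasDerivWithinAt
        · have hq : 0 < y j t / y l t * Real.exp (δ * t) :=
            mul_pos (div_pos (hpos j t ht) (hpos l t ht)) (Real.exp_pos _)
          nlinarith [hgap t ht]
      have h2 : y j t ≤ y j t / y l t := by
        rw [le_div_iff₀ (hpos l t ht)]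
        exact mul_le_of_le_one_right (hpos j t ht).le (hyl1 l t ht)
      rw [Real.exp_neg, ← div_eq_mul_inv, le_div_iff₀ (Real.exp_pos _)]
      exact (mul_le_mul_of_nonneg_right h2 (Real.exp_pos _).le).trans h1
    have hlim : Tendsto (fun t => (y j 0 / y l 0) * Real.exp (-(δ * t))) atTop (𝓝 0) := by
      have : Tendsto (fun t : ℝ => δ * t) atTop atTop := tendsto_id.const_mul_atTop hδ
      simpa using (Real.tendsto_exp_neg_atTop_nhds_zero.comp this).const_mul (y j 0 / y l 0)
    refine tendsto_of_tendsto_of_tendsto_of_le_of_le' tendsto_const_nhds hlim ?_ ?_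
    · filter_upwards [eventually_ge_atTop 0] with t ht using (hpos j t ht).le
    · filter_upwards [eventually_ge_atTop 0] with t ht using hdecay t ht
  rcases eq_or_ne k l with rfl | hkl
  swap
  · simpa [hkl] using hzero k hkl
  simp only [if_true]
  -- the dominant coordinate grows until it reaches one
  rw [Metric.tendsto_atTop]
  intro ε hε
  suffices h : ∃ T, 0 ≤ T ∧ 1 - ε < y k T by
    obtain ⟨T, hT, hy⟩ := h
    refine ⟨T, fun t ht => ?_⟩
    rw [Real.dist_eq, abs_sub_lt_iff]
    have h1 := hmono T t hT ht
    have h2 := hyl1 k t (hT.trans ht)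
    constructor <;> linarith
  -- If `y k` stayed below `1 - ε`, then, once the other squares sum to less than `ε`, the squared
  -- norm would be below `(1 - ε)^2 + ε < 1`. The correction then vanishes and `y k` grows at a
  -- fixed positive speed, which is absurd.
  by_contra! hcon
  have hε1 : ε < 1 := by
    have := hcon 0 le_rfl
    linarith
  have hother : Tendsto (fun t => ∑ j ∈ Finset.univ.erase k, y j t ^ 2) atTop (𝓝 0) := by
    have : Tendsto (fun t => ∑ j ∈ Finset.univ.erase k, y j t ^ 2) atTop
        (𝓝 (∑ j ∈ Finset.univ.erase k, (0 : ℝ) ^ 2)) :=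
      tendsto_finsetSum _ fun j hj => (hzero j (Finset.ne_of_mem_erase hj)).pow 2
    simpa using this
  obtain ⟨T, hT⟩ := eventually_atTop.1
    ((hother.eventually (gt_mem_nhds (show (0 : ℝ) < ε by positivity))).and
      (eventually_ge_atTop 0))
  have hT0 : 0 ≤ T := (hT T le_rfl).2
  have hgrow : ∀ t, T ≤ t → y k T + c * (m k * y k 0) * y k 0 * (t - T) ≤ y k t := by
    intro t ht
    have := le_add_mul_of_rightDeriv_le (f := fun s => -y k s)
      (C := -(c * (m k * y k 0) * y k 0))
      ((hcont k).mono (Set.Ici_subset_Ici.2 hT0)).neg (fun t ht => (hd k t (hT0.trans ht)).neg)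
      (fun t ht => ?_) ht
    · linarith
    · have ht0 := hT0.trans ht
      have hsum : ∑ j, y j t ^ 2 < 1 := by
        rw [← Finset.add_sum_erase _ _ (Finset.mem_univ k)]
        have h1 := (hT t ht).1
        have h2 := hcon t ht0
        nlinarith [hpos k t ht0]
      rw [hρ0 t ht0 hsum, sub_zero]
      have h1 := hmono 0 t le_rfl ht0
      have h2 := hrlpos t ht0
      have h3 : c * (m k * y k 0) ≤ r k t := le_trans (by gcongr) h2
      have h4 : c * (m k * y k 0) * y k 0 ≤ r k t * y k t :=
        mul_le_mul h3 h1 hl0.le (le_trans (by positivity) h3)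
      linarith
  have hv : 0 < c * (m k * y k 0) * y k 0 := by positivity
  have h1 := hgrow (T + 1 / (c * (m k * y k 0) * y k 0)) (by
    have := one_div_pos.2 hv
    linarith)
  have h2 := hcon (T + 1 / (c * (m k * y k 0) * y k 0)) (by positivity)
  have h3 := hpos k T hT0
  rw [add_sub_cancel_left, mul_one_div_cancel hv.ne'] at h1
  linarith

end Dominance


/-! ### The last column of the Muon update -/

/-- If `GᵀG` satisfies a quadratic equation on the basis vector `e`, the polar factor applied to `e`
is a polynomial in `G`, whichever decomposition is chosen. -/
theorem IsMuonUpdate.col_eq {m n : Type} [Fintype m] [Fintype n] [DecidableEq n]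
    {G O : Matrix m n ℝ} (hO : IsMuonUpdate G O) (e : n) {T h τ : ℝ} (hh : 0 < h) (hτ : 0 < τ)
    (hT : τ ^ 2 = T + 2 * h)
    (hM : G.transpose.mulVec (G.mulVec (G.transpose.mulVec (G.mulVec (Pi.single e 1)))) =
      T • G.transpose.mulVec (G.mulVec (Pi.single e 1)) - h ^ 2 • Pi.single e 1) (i : m) :
    O i e = h⁻¹ * (τ * G i e -
      τ⁻¹ * (G.mulVec (G.transpose.mulVec (G.mulVec (Pi.single e 1))) i + h * G i e)) := by
  obtain ⟨r, U, V, D, hU, hV, hD, rfl, rfl⟩ := hO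
  set G := U * Matrix.diagonal D * V.transpose with hG
  set p : n → ℝ := Pi.single e 1 with hp
  set a := V.transpose.mulVec p with ha
  have hGp : ∀ x, G.mulVec x = U.mulVec (fun i => D i * V.transpose.mulVec x i) := by
    intro x
    rw [hG, ← Matrix.mulVec_mulVec, ← Matrix.mulVec_mulVec]
    congr 1
    ext i
    rw [Matrix.mulVec_diagonal]
  have hGt : ∀ b, G.transpose.mulVec (U.mulVec b) = V.mulVec (fun i => D i * b i) := by
    intro b
    rw [hG, Matrix.transpose_mul, Matrix.transpose_mul, Matrix.mulVec_mulVec, Matrix.mul_assoc,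
      Matrix.mul_assoc, hU, Matrix.mul_one, Matrix.transpose_transpose, Matrix.diagonal_transpose,
      ← Matrix.mulVec_mulVec]
    congr 1
    ext i
    rw [Matrix.mulVec_diagonal]
  have hVV : ∀ b, V.transpose.mulVec (V.mulVec b) = b := by
    intro b
    rw [Matrix.mulVec_mulVec, hV, Matrix.one_mulVec]
  have hcol : ∀ (A : Matrix m n ℝ), A i e = A.mulVec p i := by
    intro A
    rw [hp, Matrix.mulVec_single_one]
    rfl
  have hrel : ∀ j, D j * (D j * (D j * (D j * a j))) = T * (D j * (D j * a j)) - h ^ 2 * a j := by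
    intro j
    have h1 := congrFun (congrArg V.transpose.mulVec hM) j
    rw [Matrix.mulVec_sub, Matrix.mulVec_smul, Matrix.mulVec_smul] at h1
    simp only [hGp, hGt, hVV] at h1
    simpa using h1
  -- With `T = τ² - 2h`, the quartic `D⁴ - T D² + h²` equals `(D² + h - τ D)(D² + h + τ D)`, and
  -- positivity of `D` excludes the second factor.
  have hfac : ∀ j, D j * (D j * a j) + h * a j = τ * (D j * a j) := by
    intro j
    have h1 : (D j ^ 2 + h + τ * D j) * (D j * (D j * a j) + h * a j - τ * (D j * a j)) = 0 := by
      linear_combination hrel j - D j ^ 2 * a j * hT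
    have h2 : D j ^ 2 + h + τ * D j ≠ 0 := by
      have := hD j
      positivity
    have := (mul_eq_zero.1 h1).resolve_left h2
    linarith
  rw [hcol (U * V.transpose), hcol G, ← Matrix.mulVec_mulVec, ← ha]
  simp only [hGp, hGt, hVV, ← ha]
  -- `D² a` is rewritten through `D³ a` and `D a`: only odd powers return to the ambient space, as
  -- `U D Vᵀ = G` and `U D³ Vᵀ = G Gᵀ G`.
  have hvec : a = h⁻¹ • (τ • (fun j => D j * a j) -
      τ⁻¹ • ((fun j => D j * (D j * (D j * a j))) + h • fun j => D j * a j)) := by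
    ext j
    simp only [Pi.smul_apply, Pi.sub_apply, Pi.add_apply, smul_eq_mul]
    have := hfac j
    have h2 : D j * (D j * (D j * a j)) + h * (D j * a j) = τ * (D j * (D j * a j)) := by
      linear_combination D j * this
    rw [h2]
    field_simp
    linarith
  conv_lhs => rw [hvec]
  simp only [Matrix.mulVec_smul, Matrix.mulVec_sub, Matrix.mulVec_add, Pi.smul_apply,
    Pi.sub_apply, Pi.add_apply, smul_eq_mul]

section Augmented

variable {L d : ℕ} (ζ : Modes L d) (S : Finset (Fin L)) (g : Weight d)

theorem augmented_mulVec (x : Option S → ℝ) (i : Fin d) :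
    (augmented ζ S g).mulVec x i = (x none • g + ∑ s : S, x (some s) • ζ s : Weight d) i := by
  simp [augmented, Matrix.mulVec, dotProduct, Fintype.sum_option, mul_comm]

theorem augmented_transpose_mulVec (v : Weight d) :
    (augmented ζ S g).transpose.mulVec (fun i => v i) =
      fun o => o.elim ⟪g, v⟫ (fun s => ⟪ζ s, v⟫) := by
  ext o
  cases o <;>
  simp [augmented, Matrix.mulVec, dotProduct, PiLp.inner_apply, mul_comm]

theorem inner_eq_sum (u v : Weight d) : ⟪u, v⟫ = ∑ k, ⟪ζ k, u⟫ * ⟪ζ k, v⟫ := by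
  rw [← ζ.sum_inner_mul_inner u v]
  exact Finset.sum_congr rfl fun k _ => by rw [real_inner_comm]

/-- The Gram matrix is an identity bordered by the collected coordinates of `g`. On the span of the
last basis vector and its image it has trace `1 + ‖g‖²` and determinant `h²`; so `h` and `τ` play
the roles of the product and the sum of the two relevant singular values. -/
theorem muon_coord {O : Matrix (Fin d) (Option S) ℝ} (hO : IsMuonUpdate (augmented ζ S g) O)
    {g' : Weight d} (hg' : ∀ i, g' i = O i none) {h τ : ℝ} (hh : 0 < h) (hτ : 0 < τ)
    (hh2 : h ^ 2 = ∑ k ∈ Sᶜ, ⟪ζ k, g⟫ ^ 2)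
    (hτ2 : τ ^ 2 = ∑ k ∈ S, ⟪ζ k, g⟫ ^ 2 + (1 + h) ^ 2) (k : Fin L) :
    ⟪ζ k, g'⟫ = if k ∈ S then τ⁻¹ * ⟪ζ k, g⟫ else τ⁻¹ * (1 + h⁻¹) * ⟪ζ k, g⟫ := by
  classical
  set γ : Fin L → ℝ := fun k => ⟪ζ k, g⟫ with hγ
  set N : ℝ := ⟪g, g⟫ with hN
  have hNsum : N = ∑ k ∈ S, γ k ^ 2 + h ^ 2 := by
    rw [hN, inner_eq_sum ζ, hh2, Finset.sum_add_sum_compl]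
    exact Finset.sum_congr rfl fun k _ => by rw [sq]
  set u : Weight d := N • g + ∑ s : S, γ s • ζ s with hu
  have horth : ∀ k, ⟪ζ k, ∑ s : S, γ s • ζ s⟫ = if k ∈ S then γ k else 0 := by
    intro k
    rw [Finset.sum_coe_sort S (fun s => γ s • ζ s), inner_sum]
    simp [inner_smul_right, orthonormal_iff_ite.1 ζ.orthonormal]
  have h0 : (augmented ζ S g).mulVec (Pi.single none 1) = fun i => g i := by
    ext i
    rw [augmented_mulVec]
    simp
  have h1 : (augmented ζ S g).transpose.mulVec ((augmented ζ S g).mulVec (Pi.single none 1)) =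
      fun o => o.elim N (fun s => γ s) := by
    rw [h0, augmented_transpose_mulVec]
  have h2 : (augmented ζ S g).mulVec ((augmented ζ S g).transpose.mulVec
      ((augmented ζ S g).mulVec (Pi.single none 1))) = fun i => u i := by
    ext i
    rw [h1, augmented_mulVec]
    rfl
  have hku : ∀ k, ⟪ζ k, u⟫ = N * γ k + if k ∈ S then γ k else 0 := by
    intro k
    rw [hu, inner_add_right, inner_smul_right, horth]
  have hgu : ⟪g, u⟫ = N * N + ∑ k ∈ S, γ k ^ 2 := by
    rw [hu, inner_add_right, inner_smul_right, Finset.sum_coe_sort S (fun s => γ s • ζ s),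
      inner_sum]
    congr 1
    refine Finset.sum_congr rfl fun k _ => ?_
    rw [inner_smul_right, real_inner_comm, sq]
  have hcol := hO.col_eq none (T := 1 + N) hh hτ (by rw [hτ2, hNsum]; ring) (by
    rw [h2, augmented_transpose_mulVec, h1]
    ext o
    cases o with
    | none =>
      simp only [Option.elim, hgu, Pi.sub_apply, Pi.smul_apply, Pi.single_eq_same, smul_eq_mul]
      rw [hNsum]; ring
    | some s =>
      simp only [Option.elim, hku, Pi.sub_apply, Pi.smul_apply, smul_eq_mul]
      simp
      ring)
  have hg'eq : g' = h⁻¹ • (τ • g - τ⁻¹ • (u + h • g)) := by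
    ext i
    rw [hg' i, hcol i, h2]
    simp only [augmented, Matrix.of_apply, Option.elim, PiLp.smul_apply, PiLp.sub_apply,
      PiLp.add_apply, smul_eq_mul]
  rw [hg'eq]
  simp only [inner_smul_right, inner_sub_right, inner_add_right, hku]
  have hτN : τ ^ 2 = N + 1 + 2 * h := by rw [hτ2, hNsum]; ring
  change h⁻¹ * (τ * γ k - τ⁻¹ * ((N * γ k + if k ∈ S then γ k else 0) + h * γ k)) = _
  split_ifs
  · field_simp
    linear_combination γ k * hτN
  · field_simp
    linear_combination γ k * hτN

/-- The norm is in fact one when `h > 0`. The bound serves to give `ρ ≤ 1` along the Muon flow. -/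
theorem muon_norm_le_one {O : Matrix (Fin d) (Option S) ℝ}
    (hO : IsMuonUpdate (augmented ζ S g) O)
    {g' : Weight d} (hg' : ∀ i, g' i = O i none) {h τ : ℝ} (hh : 0 < h) (hτ : 0 < τ)
    (hh2 : h ^ 2 = ∑ k ∈ Sᶜ, ⟪ζ k, g⟫ ^ 2)
    (hτ2 : τ ^ 2 = ∑ k ∈ S, ⟪ζ k, g⟫ ^ 2 + (1 + h) ^ 2) : ‖g'‖ ≤ 1 := by
  have hc := muon_coord ζ S g hO hg' hh hτ hh2 hτ2
  have h1 : ‖g'‖ ^ 2 = 1 := by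
    rw [← real_inner_self_eq_norm_sq, inner_eq_sum ζ, ← Finset.sum_add_sum_compl S]
    have hS : ∑ k ∈ S, ⟪ζ k, g'⟫ * ⟪ζ k, g'⟫ = τ⁻¹ ^ 2 * ∑ k ∈ S, ⟪ζ k, g⟫ ^ 2 := by
      rw [Finset.mul_sum]
      refine Finset.sum_congr rfl fun k hk => ?_
      rw [hc, if_pos hk]; ring
    have hSc : ∑ k ∈ Sᶜ, ⟪ζ k, g'⟫ * ⟪ζ k, g'⟫ =
        (τ⁻¹ * (1 + h⁻¹)) ^ 2 * ∑ k ∈ Sᶜ, ⟪ζ k, g⟫ ^ 2 := by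
      rw [Finset.mul_sum]
      refine Finset.sum_congr rfl fun k hk => ?_
      rw [hc, if_neg (Finset.mem_compl.1 hk)]; ring
    rw [hS, hSc, ← hh2, eq_sub_of_add_eq hτ2.symm]
    field_simp
    ring
  nlinarith [norm_nonneg g']

end Augmented


/-! ### Convergence of the trajectories -/

section Trajectories

variable {L d : ℕ} {ζ : Modes L d}

theorem inner_modeGradient (μ : Fin L → ℝ) (w : Weight d) (k : Fin L) :
    ⟪ζ k, modeGradient ζ μ w⟫ = μ k * ⟪ζ k, w⟫ ^ 2 := by
  simp [modeGradient, modeOperator, inner_sum, inner_smul_right,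
    orthonormal_iff_ite.1 ζ.orthonormal]
  ring

theorem inner_combination (x : Fin L → ℝ) (k : Fin L) : ⟪ζ k, combination ζ x⟫ = x k := by
  simp [combination, inner_sum, inner_smul_right, orthonormal_iff_ite.1 ζ.orthonormal]

theorem sum_inner_sq_eq (w : Weight d) : ∑ k, ⟪ζ k, w⟫ ^ 2 = ‖w‖ ^ 2 := by
  rw [← real_inner_self_eq_norm_sq, inner_eq_sum ζ]
  exact Finset.sum_congr rfl fun k _ => sq _

theorem abs_inner_mode_le_one {w : Weight d} (hw : ‖w‖ ≤ 1) (k : Fin L) : |⟪ζ k, w⟫| ≤ 1 :=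
  (abs_real_inner_le_norm _ _).trans (by simpa using hw)

theorem IsTrajectory.exists_init {R : Weight d → Weight d → Prop} {x : Fin L → ℝ}
    {w : ℝ → Weight d} (hw : IsTrajectory R (combination ζ x) w) :
    ∃ s : ℝ, 0 < s ∧ ∀ k, ⟪ζ k, w 0⟫ = s * x k :=
  ⟨(max 1 ‖combination ζ x‖)⁻¹, by positivity, fun k => by
    rw [hw.init, ballProj, inner_smul_right, inner_combination]⟩

theorem IsTrajectory.continuousOn_coord {R : Weight d → Weight d → Prop} {x₀ : Weight d}
    {w : ℝ → Weight d} (hw : IsTrajectory R x₀ w) (k : Fin L) :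
    ContinuousOn (fun t => ⟪ζ k, w t⟫) (Set.Ici 0) :=
  continuousOn_const.inner hw.cont

/-- The coordinates of a trajectory, with the radial correction `ρ`. -/
theorem IsTrajectory.exists_coord {R : Weight d → Weight d → Prop} {x₀ : Weight d}
    {w : ℝ → Weight d} (hw : IsTrajectory R x₀ w) (ζ : Modes L d) :
    ∃ (g : ℝ → Weight d) (ρ : ℝ → ℝ), ∀ t, 0 ≤ t → R (w t) (g t) ∧
      (∀ k, HasDerivWithinAt (fun s => ⟪ζ k, w s⟫) (⟪ζ k, g t⟫ - ρ t * ⟪ζ k, w t⟫)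
        (Set.Ici t) t) ∧
      (‖w t‖ < 1 → ρ t = 0) ∧ (ρ t = 0 ∨ ρ t = ⟪g t, w t⟫) := by
  have : ∀ t, ∃ (g : Weight d) (ρ : ℝ), 0 ≤ t → R (w t) g ∧
      (∀ k, HasDerivWithinAt (fun s => ⟪ζ k, w s⟫) (⟪ζ k, g⟫ - ρ * ⟪ζ k, w t⟫)
        (Set.Ici t) t) ∧
      (‖w t‖ < 1 → ρ = 0) ∧ (ρ = 0 ∨ ρ = ⟪g, w t⟫) := by
    intro t
    by_cases ht : 0 ≤ t
    swap
    · exact ⟨0, 0, fun h => absurd h ht⟩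
    obtain ⟨g, hg, hd⟩ := hw.deriv t ht
    have hcoord : ∀ k, HasDerivWithinAt (fun s => ⟪ζ k, w s⟫) ⟪ζ k, tangentProj (w t) g⟫
        (Set.Ici t) t := fun k => by
      have := (hasDerivWithinAt_const t (Set.Ici t) (ζ k)).inner ℝ hd
      simpa using this
    by_cases hc : ‖w t‖ < 1 ∨ ⟪g, w t⟫ ≤ 0
    · refine ⟨g, 0, fun _ => ⟨hg, fun k => ?_, fun _ => rfl, Or.inl rfl⟩⟩
      have := hcoord k
      rw [tangentProj, if_pos hc] at this
      simpa using this
    · refine ⟨g, ⟪g, w t⟫, fun _ => ⟨hg, fun k => ?_, fun h => absurd (Or.inl h) hc, Or.inr rfl⟩⟩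
      have := hcoord k
      rw [tangentProj, if_neg hc, inner_sub_right, inner_smul_right] at this
      exact this
  choose g ρ h using this
  exact ⟨g, ρ, h⟩

theorem tendsto_mode_of_coord {w : ℝ → Weight d} {l : Fin L}
    (h : ∀ k, Tendsto (fun t => ⟪ζ k, w t⟫) atTop (𝓝 (if k = l then 1 else 0))) :
    Tendsto w atTop (𝓝 (ζ l)) := by
  have h1 : Tendsto (fun t => ∑ k, ⟪ζ k, w t⟫ • ζ k) atTop
      (𝓝 (∑ k, (if k = l then (1 : ℝ) else 0) • ζ k)) :=
    tendsto_finsetSum _ fun k _ => (h k).smul_const _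
  simpa [ζ.sum_repr'] using h1

theorem tendsto_mode_of_rates {R : Weight d → Weight d → Prop} {x : Fin L → ℝ}
    {w : ℝ → Weight d} (hw : IsTrajectory R (combination ζ x) w)
    {g : ℝ → Weight d} {ρ : ℝ → ℝ} (hcoord : ∀ t, 0 ≤ t → R (w t) (g t) ∧
      (∀ k, HasDerivWithinAt (fun s => ⟪ζ k, w s⟫) (⟪ζ k, g t⟫ - ρ t * ⟪ζ k, w t⟫)
        (Set.Ici t) t) ∧
      (‖w t‖ < 1 → ρ t = 0) ∧ (ρ t = 0 ∨ ρ t = ⟪g t, w t⟫))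
    {r : Fin L → ℝ → ℝ} {m : Fin L → ℝ} {G : Set (Fin L)} {s : ℝ → ℝ} {c : ℝ} {l : Fin L}
    (hm : ∀ k, 0 < m k) (hl : l ∈ G) (hc : 0 < c)
    (hpos : ∀ k t, 0 ≤ t → 0 < ⟪ζ k, w t⟫)
    (hr : ∀ k t, 0 ≤ t → ⟪ζ k, g t⟫ = r k t * ⟪ζ k, w t⟫)
    (hs : ∀ t, 0 ≤ t → c ≤ s t)
    (hG : ∀ k ∈ G, ∀ t, 0 ≤ t → r k t = s t * (m k * ⟪ζ k, w t⟫))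
    (hGc : ∀ k ∉ G, ∀ t, 0 ≤ t → (∀ j ∈ G, m j * ⟪ζ j, w t⟫ ≤ m l * ⟪ζ l, w t⟫) →
      r k t + c * (m l * ⟪ζ l, w t⟫) ≤ r l t)
    (h0 : ∀ k ∈ G, k ≠ l → m k * x k < m l * x l) : Tendsto w atTop (𝓝 (ζ l)) := by
  refine tendsto_mode_of_coord fun k => ?_
  have hsum : ∀ t, ∑ k, ⟪ζ k, w t⟫ ^ 2 = ‖w t‖ ^ 2 := fun t => sum_inner_sq_eq (w t)
  refine tendsto_of_dominant (y := fun k t => ⟪ζ k, w t⟫) (r := r) (ρ := ρ) (s := s) hm hl hc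
    (fun k => hw.continuousOn_coord k) hpos (fun t ht => ?_) (fun k t ht => ?_)
    (fun t ht h => ?_) (fun t ht => ?_) hs hG hGc (fun k hk hkl => ?_) k
  · rw [hsum]
    have := hw.norm_le t ht
    exact pow_le_one₀ (norm_nonneg _) this
  · refine ((hcoord t ht).2.1 k).congr_deriv ?_
    rw [hr k t ht]; ring
  · rw [hsum] at h
    exact (hcoord t ht).2.2.1 (by nlinarith [norm_nonneg (w t)])
  · refine (hcoord t ht).2.2.2.imp_right fun h => ?_
    rw [h, inner_eq_sum ζ]
    refine Finset.sum_congr rfl fun k _ => ?_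
    rw [hr k t ht]; ring
  · obtain ⟨σ, hσ, hi⟩ := hw.exists_init
    simp only [hi]
    have := h0 k hk hkl
    nlinarith

theorem tendsto_of_gradientRule {m x : Fin L → ℝ} {w : ℝ → Weight d} {l : Fin L}
    (hm : ∀ k, 0 < m k) (hx : ∀ k, 0 < x k) (hl : ∀ k, k ≠ l → m k * x k < m l * x l)
    (hw : IsTrajectory (gradientRule ζ m) (combination ζ x) w) :
    Tendsto w atTop (𝓝 (ζ l)) := by
  obtain ⟨g, ρ, hcoord⟩ := hw.exists_coord ζ
  have hg : ∀ k t, 0 ≤ t → ⟪ζ k, g t⟫ = m k * ⟪ζ k, w t⟫ ^ 2 := fun k t ht => by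
    rw [(hcoord t ht).1, inner_modeGradient]
  have hpos : ∀ k t, 0 ≤ t → 0 < ⟪ζ k, w t⟫ := by
    intro k t ht
    refine pos_of_rightDeriv (y := fun t => ⟪ζ k, w t⟫) (g := fun t => ⟪ζ k, g t⟫) (ρ := ρ)
      -- A nonzero `ρ` equals the sum of `m j * y j ^ 3`, and `|y j| ≤ 1`.
      (C := ∑ j, m j) ?_ (hw.continuousOn_coord k) (fun t ht => (hcoord t ht).2.1 k)
      (fun t ht _ => ⟨?_, ?_⟩) ht
    · obtain ⟨σ, hσ, hi⟩ := hw.exists_init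
      simp only [hi]
      exact mul_pos hσ (hx k)
    · simp only [hg k t ht]
      have := hm k
      positivity
    · rcases (hcoord t ht).2.2.2 with h | h
      · rw [h]
        exact Finset.sum_nonneg fun j _ => (hm j).le
      · rw [h, inner_eq_sum ζ]
        refine Finset.sum_le_sum fun j _ => ?_
        rw [hg j t ht, mul_assoc]
        refine mul_le_of_le_one_right (hm j).le ?_
        have := abs_le.1 (abs_inner_mode_le_one (ζ := ζ) (hw.norm_le t ht) j)
        have h2 : ⟪ζ j, w t⟫ ^ 2 ≤ 1 := by nlinarith
        nlinarith [sq_nonneg ⟪ζ j, w t⟫]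
  exact tendsto_mode_of_rates hw hcoord (r := fun k t => m k * ⟪ζ k, w t⟫) (G := Set.univ)
    (s := fun _ => 1) (c := 1) hm (Set.mem_univ l) one_pos hpos
    (fun k t ht => by rw [hg k t ht]; ring) (fun _ _ => le_rfl) (fun k _ t _ => (one_mul _).symm)
    (fun k hk => absurd (Set.mem_univ k) hk) (fun k _ hkl => hl k hkl)

/-- Under the Muon rule, a node converges to the dominant one of the modes that have not been
collected. -/
theorem tendsto_of_muonRule {μ x : Fin L → ℝ} {S : Finset (Fin L)} {w : ℝ → Weight d} {l : Fin L}
    (hμ : ∀ k, 0 < μ k) (hμ1 : ∀ k, μ k ≤ 1) (hx : ∀ k, 0 < x k) (hlS : l ∉ S)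
    (hl : ∀ k, k ∉ S → k ≠ l → μ k * x k < μ l * x l)
    (hw : IsTrajectory (muonRule ζ μ S) (combination ζ x) w) :
    Tendsto w atTop (𝓝 (ζ l)) := by
  obtain ⟨g, ρ, hcoord⟩ := hw.exists_coord ζ
  set y : Fin L → ℝ → ℝ := fun k t => ⟪ζ k, w t⟫ with hy
  set γ : Fin L → ℝ → ℝ := fun k t => μ k * y k t ^ 2 with hγ
  set h : ℝ → ℝ := fun t => √(∑ k ∈ Sᶜ, γ k t ^ 2) with hh
  set τ : ℝ → ℝ := fun t => √(∑ k ∈ S, γ k t ^ 2 + (1 + h t) ^ 2) with hτ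
  have hγi : ∀ k t, ⟪ζ k, modeGradient ζ μ (w t)⟫ = γ k t := fun k t => inner_modeGradient μ _ k
  have hsum0 : ∀ (A : Finset (Fin L)) t, 0 ≤ ∑ k ∈ A, γ k t ^ 2 :=
    fun A t => Finset.sum_nonneg fun _ _ => sq_nonneg _
  have hh0 : ∀ t, 0 ≤ h t := fun t => Real.sqrt_nonneg _
  have hh2 : ∀ t, h t ^ 2 = ∑ k ∈ Sᶜ, γ k t ^ 2 := fun t => Real.sq_sqrt (hsum0 _ t)
  have hτ2 : ∀ t, τ t ^ 2 = ∑ k ∈ S, γ k t ^ 2 + (1 + h t) ^ 2 := fun t =>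
    Real.sq_sqrt (add_nonneg (hsum0 _ t) (sq_nonneg _))
  have hτ0 : ∀ t, 0 < τ t := fun t => Real.sqrt_pos.2 (by
    have := hsum0 S t
    have := hh0 t
    positivity)
  have hgcoord : ∀ k t, 0 ≤ t → 0 < h t →
      ⟪ζ k, g t⟫ = if k ∈ S then (τ t)⁻¹ * γ k t else (τ t)⁻¹ * (1 + (h t)⁻¹) * γ k t := by
    intro k t ht hht
    obtain ⟨O, hO, hgO⟩ := (hcoord t ht).1
    have := muon_coord ζ S _ hO hgO hht (hτ0 t) (by simp only [hγi, hh2]) (by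
      simp only [hγi, hτ2]) k
    simpa only [hγi] using this
  have hρ1 : ∀ t, 0 ≤ t → 0 < h t → ρ t ≤ 1 := by
    intro t ht hht
    rcases (hcoord t ht).2.2.2 with h1 | h1
    · rw [h1]; exact zero_le_one
    obtain ⟨O, hO, hgO⟩ := (hcoord t ht).1
    have h2 := muon_norm_le_one ζ S _ hO hgO hht (hτ0 t) (by simp only [hγi, hh2]) (by
      simp only [hγi, hτ2])
    rw [h1]
    exact (real_inner_le_norm _ _).trans (mul_le_one₀ h2 (norm_nonneg _) (hw.norm_le t ht))
  have hinit : ∀ k, 0 < y k 0 := by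
    obtain ⟨σ, hσ, hi⟩ := hw.exists_init
    intro k
    simp only [hy, hi]
    exact mul_pos hσ (hx k)
  have hγ0 : ∀ k t, 0 ≤ γ k t := fun k t => mul_nonneg (hμ k).le (sq_nonneg _)
  have hgnn : ∀ k t, 0 ≤ t → 0 < h t → 0 ≤ ⟪ζ k, g t⟫ := by
    intro k t ht hht
    have := hγ0 k t
    have := hτ0 t
    rw [hgcoord k t ht hht]
    split_ifs <;> positivity
  have hhpos_of : ∀ k, k ∉ S → ∀ t, 0 < y k t → 0 < h t := by
    intro k hk t hkt
    refine Real.sqrt_pos.2 (Finset.sum_pos' (fun _ _ => sq_nonneg _)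
      ⟨k, Finset.mem_compl.2 hk, ?_⟩)
    have := hμ k
    positivity
  -- The formula for the update needs `h > 0`, which needs a positive uncollected coordinate. The
  -- circle is broken by treating `l` first, where `y l > 0` itself yields `h > 0`; the other
  -- coordinates follow.
  have hlpos : ∀ t, 0 ≤ t → 0 < y l t := fun t ht =>
    pos_of_rightDeriv (g := fun t => ⟪ζ l, g t⟫) (ρ := ρ) (C := 1) (hinit l)
      (hw.continuousOn_coord l) (fun t ht => (hcoord t ht).2.1 l)
      (fun t ht hp => ⟨hgnn l t ht (hhpos_of l hlS t hp), hρ1 t ht (hhpos_of l hlS t hp)⟩) ht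
  have hhpos : ∀ t, 0 ≤ t → 0 < h t := fun t ht => hhpos_of l hlS t (hlpos t ht)
  have hpos : ∀ k t, 0 ≤ t → 0 < y k t := fun k t ht =>
    pos_of_rightDeriv (g := fun t => ⟪ζ k, g t⟫) (ρ := ρ) (C := 1) (hinit k)
      (hw.continuousOn_coord k) (fun t ht => (hcoord t ht).2.1 k)
      (fun t ht _ => ⟨hgnn k t ht (hhpos t ht), hρ1 t ht (hhpos t ht)⟩) ht
  have hysum : ∀ t, 0 ≤ t → ∑ k, y k t ^ 2 ≤ 1 := fun t ht => by
    rw [sum_inner_sq_eq]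
    exact pow_le_one₀ (norm_nonneg _) (hw.norm_le t ht)
  have hysub : ∀ (A : Finset (Fin L)) t, 0 ≤ t → ∑ k ∈ A, y k t ^ 2 ≤ 1 := fun A t ht =>
    (Finset.sum_le_univ_sum_of_nonneg fun _ => sq_nonneg _).trans (hysum t ht)
  have hy1 : ∀ k t, 0 ≤ t → y k t ≤ 1 := fun k t ht =>
    (abs_le.1 (abs_inner_mode_le_one (hw.norm_le t ht) k)).2
  have hμy : ∀ k t, 0 ≤ t → μ k * y k t ≤ 1 := fun k t ht =>
    mul_le_one₀ (hμ1 k) (hpos k t ht).le (hy1 k t ht)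
  -- Since `γ k = (μ k * y k) * y k` and the squares `y k ^ 2` sum to at most one, the length of `γ`
  -- on `A` is at most the largest `μ k * y k` there.
  have hγle : ∀ (A : Finset (Fin L)) t, 0 ≤ t → ∀ b, 0 ≤ b → (∀ k ∈ A, μ k * y k t ≤ b) →
      ∑ k ∈ A, γ k t ^ 2 ≤ b ^ 2 := by
    intro A t ht b hb hAb
    calc ∑ k ∈ A, γ k t ^ 2 ≤ ∑ k ∈ A, b ^ 2 * y k t ^ 2 := by
          refine Finset.sum_le_sum fun k hk => ?_
          have h1 : 0 ≤ μ k * y k t := (mul_pos (hμ k) (hpos k t ht)).le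
          have h2 : γ k t ^ 2 = (μ k * y k t) ^ 2 * y k t ^ 2 := by simp only [hγ]; ring
          rw [h2]
          have := hAb k hk
          gcongr
      _ = b ^ 2 * ∑ k ∈ A, y k t ^ 2 := by rw [Finset.mul_sum]
      _ ≤ b ^ 2 := mul_le_of_le_one_right (sq_nonneg b) (hysub A t ht)
  have hτ3 : ∀ t, 0 ≤ t → τ t ≤ 3 := by
    intro t ht
    have h1 := hγle S t ht 1 zero_le_one fun k _ => hμy k t ht
    have h2 := hγle Sᶜ t ht 1 zero_le_one fun k _ => hμy k t ht
    have h3 := hτ2 t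
    have h4 := hh2 t
    have h5 := hh0 t
    have h6 : h t ≤ 1 := by nlinarith
    nlinarith [hτ0 t]
  have hτinv : ∀ t, 0 ≤ t → (1 / 3 : ℝ) ≤ (τ t)⁻¹ := fun t ht => by
    rw [one_div]
    exact inv_anti₀ (hτ0 t) (hτ3 t ht)
  refine tendsto_mode_of_rates hw hcoord
    (r := fun k t => if k ∈ S then (τ t)⁻¹ * (μ k * y k t) else
      (τ t)⁻¹ * (1 + (h t)⁻¹) * (μ k * y k t))
    (G := {k | k ∉ S}) (s := fun t => (τ t)⁻¹ * (1 + (h t)⁻¹)) (c := 1 / 3) (m := μ) hμ hlS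
    (by norm_num) hpos (fun k t ht => ?_) (fun t ht => ?_) (fun k hk t ht => if_neg hk)
    (fun k hk t ht hord => ?_) (fun k hk hkl => hl k hk hkl)
  · rw [hgcoord k t ht (hhpos t ht)]
    simp only [hγ, hy]
    split_ifs <;> ring
  · have h1 := hτinv t ht
    have h2 := inv_pos.2 (hhpos t ht)
    have h3 := inv_pos.2 (hτ0 t)
    nlinarith [mul_pos h3 h2]
  · have hkS : k ∈ S := by simpa using hk
    simp only [if_pos hkS, if_neg hlS]
    have hb : 0 < μ l * y l t := mul_pos (hμ l) (hpos l t ht)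
    have hhle : h t ≤ μ l * y l t := by
      have h1 := hγle Sᶜ t ht _ hb.le fun j hj => hord j (Finset.mem_compl.1 hj)
      rw [← hh2] at h1
      exact (sq_le_sq₀ (hh0 t) hb.le).1 h1
    -- The boost `1/h` alone lifts the leading new mode to at least `1`, which bounds every
    -- collected `μ k * y k`; the unboosted part of its rate is the strict margin.
    have h1 : 1 ≤ (h t)⁻¹ * (μ l * y l t) := by
      rw [inv_mul_eq_div]
      exact (one_le_div (hhpos t ht)).2 hhle
    have h2 := hτinv t ht
    have h3 := inv_pos.2 (hτ0 t)
    have h4 := hμy k t ht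
    have h5 : (1 / 3 : ℝ) * (μ l * y l t) ≤ (τ t)⁻¹ * (μ l * y l t) := by gcongr
    have h6 : (τ t)⁻¹ * (μ k * y k t) ≤ (τ t)⁻¹ * ((h t)⁻¹ * (μ l * y l t)) := by
      have := h4.trans h1
      gcongr
    calc _ ≤ (τ t)⁻¹ * ((h t)⁻¹ * (μ l * y l t)) + (τ t)⁻¹ * (μ l * y l t) := add_le_add h6 h5
      _ = _ := by ring

end Trajectories


/-! ### The Fréchet law and the probability that a mode dominates -/

instance : IsProbabilityMeasure (expMeasure 1) := isProbabilityMeasure_expMeasure one_pos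

instance : NullSingletonClass (expMeasure 1) := by
  unfold expMeasure gammaMeasure
  infer_instance

theorem expMeasure_one_Ici {c : ℝ} (hc : 0 ≤ c) :
    expMeasure 1 (Set.Ici c) = ENNReal.ofReal (Real.exp (-c)) := by
  have h1 : (expMeasure 1).real (Set.Iic c) = 1 - Real.exp (-c) := by
    rw [← cdf_eq_real, cdf_expMeasure_eq one_pos, if_pos hc, one_mul]
  have h2 : (expMeasure 1).real (Set.Ici c) = Real.exp (-c) := by
    have h3 := probReal_compl_eq_one_sub (μ := expMeasure 1) (measurableSet_Iic (a := c))
    rw [Set.compl_Iic, h1] at h3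
    rw [← measureReal_congr Ioi_ae_eq_Ici, h3]
    ring
  rw [← h2, ofReal_measureReal]

theorem expMeasure_one_ae_pos : ∀ᵐ s ∂(expMeasure 1), 0 < s := by
  have h : (expMeasure 1) (Set.Ici 0)ᶜ = 0 := by
    rw [prob_compl_eq_zero_iff measurableSet_Ici, expMeasure_one_Ici le_rfl]
    simp
  have h2 : (Set.Ioi (0 : ℝ)) =ᵐ[expMeasure 1] Set.Ici 0 := Ioi_ae_eq_Ici
  rw [ae_iff]
  have h3 := measure_congr h2.compl
  rw [h] at h3
  exact h3

/-- Tilting the standard exponential density by `exp (-c s)` gives `1/(1+c)` times the exponential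
density of rate `1 + c`. -/
theorem lintegral_exp_expMeasure_one {c : ℝ} (hc : 0 ≤ c) :
    ∫⁻ s, ENNReal.ofReal (Real.exp (-(c * s))) ∂(expMeasure 1) = ENNReal.ofReal (1 / (1 + c)) := by
  have h1 : expMeasure 1 = volume.withDensity (exponentialPDF 1) := rfl
  have hmeas : ∀ r, Measurable (exponentialPDF r) := fun r =>
    (measurable_exponentialPDFReal r).ennreal_ofReal
  rw [h1, lintegral_withDensity_eq_lintegral_mul _ (hmeas 1) (by fun_prop)]
  have h2 : ∀ s, (exponentialPDF 1 * fun s => ENNReal.ofReal (Real.exp (-(c * s)))) s =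
      ENNReal.ofReal (1 / (1 + c)) * exponentialPDF (1 + c) s := by
    intro s
    simp only [Pi.mul_apply, exponentialPDF_eq]
    rw [← ENNReal.ofReal_mul' (Real.exp_pos _).le, ← ENNReal.ofReal_mul (by positivity)]
    congr 1
    split_ifs
    · rw [← mul_assoc, one_div_mul_cancel (by positivity), one_mul, one_mul, one_mul,
        ← Real.exp_add]
      congr 1
      ring
    · simp
  rw [lintegral_congr h2, lintegral_const_mul _ (hmeas _),
    lintegral_exponentialPDF_eq_one (by positivity), mul_one]

section Frechet

variable {Ω : Type*} [MeasurableSpace Ω] {P : Measure Ω} {a : ℝ}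

theorem rpow_neg_inv_le_iff (ha : 0 < a) {s x : ℝ} (hs : 0 < s) (hx : 0 < x) :
    s ^ (-a⁻¹) ≤ x ↔ x ^ (-a) ≤ s := by
  rw [Real.rpow_neg hs.le, Real.rpow_neg hx.le, inv_le_comm₀ (by positivity) hx,
    inv_le_comm₀ (by positivity) hs, Real.le_rpow_inv_iff_of_pos (by positivity) hs.le ha,
    Real.inv_rpow hx.le]
  exact inv_le_comm₀ (by positivity) hs

/-- The distribution function is prescribed only for `x > 0`; letting `x` decrease to zero excludes
nonpositive values. -/
theorem frechet_le_of_nonpos [IsProbabilityMeasure P] {X : Ω → ℝ} (ha : 0 < a)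
    (hcdf : ∀ x, 0 < x → P {ω | X ω ≤ x} = ENNReal.ofReal (Real.exp (-x ^ (-a)))) :
    P {ω | X ω ≤ 0} = 0 := by
  have h1 : Tendsto (fun x : ℝ => ENNReal.ofReal (Real.exp (-x ^ (-a)))) (𝓝[>] 0) (𝓝 0) := by
    rw [← ENNReal.ofReal_zero]
    refine (ENNReal.continuous_ofReal.tendsto 0).comp (Real.tendsto_exp_neg_atTop_nhds_zero.comp ?_)
    exact tendsto_rpow_neg_nhdsGT_zero (by linarith)
  refine le_antisymm (ge_of_tendsto h1 ?_) zero_le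
  filter_upwards [self_mem_nhdsWithin] with x hx
  rw [← hcdf x hx]
  exact measure_mono fun ω hω => le_trans (Set.mem_ofPred_eq ▸ hω) (le_of_lt hx)

theorem frechet_map_eq [IsProbabilityMeasure P] {X : Ω → ℝ} (ha : 0 < a) (hX : Measurable X)
    (hcdf : ∀ x, 0 < x → P {ω | X ω ≤ x} = ENNReal.ofReal (Real.exp (-x ^ (-a)))) :
    P.map X = (expMeasure 1).map (fun s => s ^ (-a⁻¹)) := by
  have hm : Measurable fun s : ℝ => s ^ (-a⁻¹) := by fun_prop
  have := Measure.isProbabilityMeasure_map (μ := P) hX.aemeasurable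
  refine Measure.ext_of_Iic _ _ fun x => ?_
  rw [Measure.map_apply hX measurableSet_Iic, Measure.map_apply hm measurableSet_Iic]
  rcases le_or_gt x 0 with hx | hx
  · have h1 : P (X ⁻¹' Set.Iic x) = 0 :=
      measure_mono_null (fun ω hω => le_trans hω hx) (frechet_le_of_nonpos ha hcdf)
    rw [h1, eq_comm, measure_eq_zero_iff_ae_notMem]
    filter_upwards [expMeasure_one_ae_pos] with s hs hsx
    exact absurd (hsx.trans hx) (not_le.2 (Real.rpow_pos_of_pos hs _))
  · have h1 : (fun s : ℝ => s ^ (-a⁻¹)) ⁻¹' Set.Iic x =ᵐ[expMeasure 1] Set.Ici (x ^ (-a)) := by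
      filter_upwards [expMeasure_one_ae_pos] with s hs
      exact propext (rpow_neg_inv_le_iff ha hs hx)
    rw [measure_congr h1, expMeasure_one_Ici (by positivity)]
    exact hcdf x hx

theorem frechet_lt [IsProbabilityMeasure P] {X : Ω → ℝ} (ha : 0 < a) (hX : Measurable X)
    (hcdf : ∀ x, 0 < x → P {ω | X ω ≤ x} = ENNReal.ofReal (Real.exp (-x ^ (-a))))
    {x : ℝ} (hx : 0 < x) : P {ω | X ω < x} = ENNReal.ofReal (Real.exp (-x ^ (-a))) := by
  rw [← hcdf x hx]
  have hm : Measurable fun s : ℝ => s ^ (-a⁻¹) := by fun_prop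
  have h1 : P.map X {x} = 0 := by
    rw [frechet_map_eq ha hX hcdf, Measure.map_apply hm (measurableSet_singleton x)]
    -- Real powers of zero or of negative bases carry no information here, so these `s` are simply
    -- added to the null set.
    refine measure_mono_null (t := {0} ∪ {x ^ (-a)} ∪ Set.Iio 0) (fun s hs => ?_) ?_
    · rcases lt_trichotomy s 0 with h | h | h
      · exact Or.inr h
      · exact Or.inl (Or.inl h)
      · refine Or.inl (Or.inr ?_)
        have hs' : s ^ (-a⁻¹) = x := hs
        rw [Set.mem_singleton_iff, ← hs', ← Real.rpow_mul h.le]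
        rw [neg_mul_neg, inv_mul_cancel₀ ha.ne', Real.rpow_one]
    · refine measure_union_null (measure_union_null (measure_singleton _) (measure_singleton _)) ?_
      rw [measure_eq_zero_iff_ae_notMem]
      filter_upwards [expMeasure_one_ae_pos] with s hs h
      exact lt_asymm hs h
  rw [Measure.map_apply hX (measurableSet_singleton x)] at h1
  refine measure_congr ?_
  rw [measure_eq_zero_iff_ae_notMem] at h1
  filter_upwards [h1] with ω hω
  exact propext ⟨fun h => le_of_lt h, fun h => lt_of_le_of_ne h hω⟩

theorem lintegral_exp_frechet [IsProbabilityMeasure P] {X : Ω → ℝ} (ha : 0 < a)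
    (hX : Measurable X)
    (hcdf : ∀ x, 0 < x → P {ω | X ω ≤ x} = ENNReal.ofReal (Real.exp (-x ^ (-a))))
    {c : ℝ} (hc : 0 ≤ c) :
    ∫⁻ x, ENNReal.ofReal (Real.exp (-(c * x ^ (-a)))) ∂(P.map X) =
      ENNReal.ofReal (1 / (1 + c)) := by
  rw [frechet_map_eq ha hX hcdf, lintegral_map (by fun_prop) (by fun_prop),
    ← lintegral_exp_expMeasure_one hc]
  refine lintegral_congr_ae ?_
  filter_upwards [expMeasure_one_ae_pos] with s hs
  rw [← Real.rpow_mul hs.le, neg_mul_neg, inv_mul_cancel₀ ha.ne', Real.rpow_one]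

/-- `l` is the strictly dominant index of the weighted coefficients `m_k x_k`. -/
def IsDominant {L : ℕ} (m x : Fin L → ℝ) (l : Fin L) : Prop :=
  ∀ k, k ≠ l → m k * x k < m l * x l

theorem IsDominant.unique {L : ℕ} {m x : Fin L → ℝ} {k l : Fin L} (hk : IsDominant m x k)
    (hl : IsDominant m x l) : k = l := by
  by_contra h
  exact lt_asymm (hk l (Ne.symm h)) (hl k h)

theorem measurableSet_isDominant {L : ℕ} (m : Fin L → ℝ) (l : Fin L) :
    MeasurableSet {x | IsDominant m x l} := by
  have : {x | IsDominant m x l} = ⋂ k, ⋂ (_ : k ≠ l), {x | m k * x k < m l * x l} := by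
    ext x
    simp [IsDominant]
  rw [this]
  refine MeasurableSet.iInter fun k => MeasurableSet.iInter fun _ => ?_
  exact measurableSet_lt (by fun_prop) (by fun_prop)

theorem sum_modeProb {L : ℕ} (hL : 0 < L) {m : Fin L → ℝ} (hm : ∀ k, 0 < m k) (a : ℝ) :
    ∑ l, modeProb m a l = 1 := by
  have : Nonempty (Fin L) := ⟨⟨0, hL⟩⟩
  unfold modeProb
  rw [← Finset.sum_div]
  exact div_self (Finset.sum_pos (fun k _ => Real.rpow_pos_of_pos (hm k) a)
    Finset.univ_nonempty).ne'

theorem modeProb_pos {L : ℕ} {m : Fin L → ℝ} (hm : ∀ k, 0 < m k) (a : ℝ) (l : Fin L) :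
    0 < modeProb m a l :=
  div_pos (Real.rpow_pos_of_pos (hm l) a)
    (Finset.sum_pos (fun k _ => Real.rpow_pos_of_pos (hm k) a) ⟨l, Finset.mem_univ l⟩)

/-- Given `X l = x`, the other coordinates stay below their thresholds with probability `exp (-c * x
^ (-a))`, where `c` is the sum of `(m k / m l) ^ a`. Since `X l ^ (-a)` is standard exponential, the
mean is `1/(1+c)`. -/
theorem measure_isDominant [IsProbabilityMeasure P] {L : ℕ} {X : Fin L → Ω → ℝ} (ha : 0 < a)
    (hX : ∀ k, Measurable (X k)) (hind : iIndepFun X P)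
    (hcdf : ∀ k x, 0 < x → P {ω | X k ω ≤ x} = ENNReal.ofReal (Real.exp (-x ^ (-a))))
    {m : Fin L → ℝ} (hm : ∀ k, 0 < m k) (l : Fin L) :
    P {ω | IsDominant m (fun k => X k ω) l} = ENNReal.ofReal (modeProb m a l) := by
  set E := (Finset.univ : Finset (Fin L)).erase l with hE
  set Y : Ω → E → ℝ := fun ω k => X k ω with hY
  have hYm : Measurable Y := measurable_pi_lambda _ fun k => hX k
  have hXY : IndepFun (X l) Y P := by
    have h1 := hind.indepFun_finset {l} E (by simp [hE]) hX
    exact h1.comp (φ := fun x : ({l} : Finset (Fin L)) → ℝ => x ⟨l, by simp⟩)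
      (measurable_pi_apply _) measurable_id
  set A : Set (ℝ × (E → ℝ)) := {z | ∀ k : E, m k * z.2 k < m l * z.1} with hA
  have hAm : MeasurableSet A := by
    have : A = ⋂ k : E, {z | m k * z.2 k < m l * z.1} := by
      ext z
      simp [hA]
    rw [this]
    refine MeasurableSet.iInter fun k => ?_
    exact measurableSet_lt (by fun_prop) (by fun_prop)
  have h1 : {ω | IsDominant m (fun k => X k ω) l} = (fun ω => (X l ω, Y ω)) ⁻¹' A := by
    ext ω
    simp [hA, IsDominant, hY, hE]
  rw [h1, ← Measure.map_apply ((hX l).prodMk hYm) hAm,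
    (indepFun_iff_map_prod_eq_prod_map_map (hX l).aemeasurable hYm.aemeasurable).1 hXY,
    Measure.prod_apply hAm]
  set c := ∑ k ∈ E, (m k / m l) ^ a with hc
  have hc0 : 0 ≤ c := Finset.sum_nonneg fun k _ =>
    Real.rpow_nonneg (div_pos (hm k) (hm l)).le a
  have hae : ∀ᵐ x ∂(P.map (X l)), 0 < x := by
    rw [ae_map_iff (hX l).aemeasurable measurableSet_Ioi, ae_iff]
    simpa using frechet_le_of_nonpos ha (hcdf l)
  have h2 : ∫⁻ x, (P.map Y) (Prod.mk x ⁻¹' A) ∂(P.map (X l)) =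
      ∫⁻ x, ENNReal.ofReal (Real.exp (-(c * x ^ (-a)))) ∂(P.map (X l)) := by
    refine lintegral_congr_ae ?_
    filter_upwards [hae] with x hx
    rw [Measure.map_apply hYm (measurable_prodMk_left hAm)]
    have h3 : Y ⁻¹' (Prod.mk x ⁻¹' A) = ⋂ k ∈ E, X k ⁻¹' Set.Iio (m l * x / m k) := by
      ext ω
      simp [hA, hY, lt_div_iff₀ (hm _), mul_comm]
    rw [h3, hind.measure_inter_preimage_eq_mul E fun k _ => measurableSet_Iio]
    have h4 : ∀ k ∈ E, P (X k ⁻¹' Set.Iio (m l * x / m k)) =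
        ENNReal.ofReal (Real.exp (-((m k / m l) ^ a * x ^ (-a)))) := by
      intro k _
      have hk := hm k
      have hl := hm l
      have h5 := frechet_lt ha (hX k) (hcdf k) (x := m l * x / m k) (by positivity)
      refine h5.trans ?_
      congr 3
      rw [show m l * x / m k = (m k / m l)⁻¹ * x by rw [inv_div]; ring,
        Real.mul_rpow (by positivity) hx.le, Real.inv_rpow (by positivity),
        Real.rpow_neg (by positivity), inv_inv]
    rw [Finset.prod_congr rfl h4, ← ENNReal.ofReal_prod_of_nonneg fun _ _ => (Real.exp_pos _).le,
      ← Real.exp_sum, hc, Finset.sum_mul, Finset.sum_neg_distrib]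
  rw [h2, lintegral_exp_frechet ha (hX l) (hcdf l) hc0]
  congr 1
  have hl := Real.rpow_pos_of_pos (hm l) a
  have h6 : c = (∑ k ∈ E, m k ^ a) / m l ^ a := by
    rw [hc, Finset.sum_div]
    exact Finset.sum_congr rfl fun k _ => Real.div_rpow (hm k).le (hm l).le a
  have h7 : ∑ k, m k ^ a = m l ^ a + ∑ k ∈ E, m k ^ a :=
    (Finset.add_sum_erase _ _ (Finset.mem_univ l)).symm
  rw [modeProb, h7, h6]
  field_simp

/-- The disjoint dominance events have probabilities summing to one, so ties are null. -/
theorem ae_exists_isDominant [IsProbabilityMeasure P] {L : ℕ} (hL : 0 < L) {X : Fin L → Ω → ℝ}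
    (ha : 0 < a) (hX : ∀ k, Measurable (X k)) (hind : iIndepFun X P)
    (hcdf : ∀ k x, 0 < x → P {ω | X k ω ≤ x} = ENNReal.ofReal (Real.exp (-x ^ (-a))))
    {m : Fin L → ℝ} (hm : ∀ k, 0 < m k) :
    ∀ᵐ ω ∂P, ∃ l, IsDominant m (fun k => X k ω) l := by
  have hmeas : ∀ l, MeasurableSet {ω | IsDominant m (fun k => X k ω) l} := fun l =>
    (measurable_pi_lambda _ hX) (measurableSet_isDominant m l)
  have h1 : P (⋃ l, {ω | IsDominant m (fun k => X k ω) l}) = 1 := by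
    rw [measure_iUnion (fun k l hkl => Set.disjoint_left.2 fun ω hk hl => hkl (hk.unique hl))
      hmeas, tsum_fintype, Finset.sum_congr rfl fun l _ => measure_isDominant ha hX hind hcdf hm l,
      ← ENNReal.ofReal_sum_of_nonneg fun l _ => (modeProb_pos hm a l).le, sum_modeProb hL hm]
    simp
  rw [← prob_compl_eq_zero_iff (MeasurableSet.iUnion hmeas)] at h1
  rw [ae_iff]
  convert h1 using 2
  ext ω
  simp

end Frechet


/-! ### The process of collected modes -/

open Classical in
/-- The sets of modes collected when, from the set `S`, the next node adds the dominant index for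
the weights `m S`. -/
def dominantProcess {L : ℕ} (m : Finset (Fin L) → Fin L → ℝ) (x : ℕ → Fin L → ℝ) :
    ℕ → Finset (Fin L)
  | 0 => ∅
  | n + 1 => dominantProcess m x n ∪
      Finset.univ.filter (IsDominant (m (dominantProcess m x n)) (x n))

section Collecting

variable {L : ℕ} {m : Finset (Fin L) → Fin L → ℝ}

theorem dominantProcess_congr {x x' : ℕ → Fin L → ℝ} {n : ℕ} (h : ∀ j < n, x j = x' j) :
    dominantProcess m x n = dominantProcess m x' n := by
  induction n with
  | zero => rfl
  | succ n ih =>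
    simp only [dominantProcess]
    rw [ih fun j hj => h j (hj.trans n.lt_succ_self), h n n.lt_succ_self]

theorem dominantProcess_succ {x : ℕ → Fin L → ℝ} {n : ℕ} {l : Fin L}
    (h : IsDominant (m (dominantProcess m x n)) (x n) l) :
    dominantProcess m x (n + 1) = insert l (dominantProcess m x n) := by
  ext k
  simp only [dominantProcess, Finset.mem_union, Finset.mem_filter, Finset.mem_univ, true_and,
    Finset.mem_insert]
  exact ⟨fun hk => hk.elim Or.inr fun hk => Or.inl (hk.unique h),
    fun hk => hk.elim (fun e => Or.inr (e ▸ h)) Or.inl⟩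

theorem measurableSet_dominantProcess (n : ℕ) (S : Finset (Fin L)) :
    MeasurableSet {x : ℕ → Fin L → ℝ | dominantProcess m x n = S} := by
  induction n generalizing S with
  | zero => simp only [dominantProcess, MeasurableSet.const]
  | succ n ih =>
    have : {x : ℕ → Fin L → ℝ | dominantProcess m x (n + 1) = S} =
        ⋃ B : Finset (Fin L), {x | dominantProcess m x n = B} ∩
          ⋂ l : Fin L, {x | (l ∈ B ∨ IsDominant (m B) (x n) l) ↔ l ∈ S} := by
      ext x
      simp [dominantProcess, Finset.ext_iff (s₂ := S)]
    rw [this]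
    refine MeasurableSet.iUnion fun B => (ih B).inter (MeasurableSet.iInter fun l => ?_)
    have h1 : MeasurableSet {x : ℕ → Fin L → ℝ | IsDominant (m B) (x n) l} :=
      (show Measurable fun x : ℕ → Fin L → ℝ => x n from measurable_pi_apply n)
        (measurableSet_isDominant (m B) l)
    by_cases hB : l ∈ B <;> by_cases hS : l ∈ S <;> simp only [hB, hS, true_or, false_or, iff_true,
      iff_false, not_true, MeasurableSet.const]
    exacts [h1, h1.compl]

end Collecting

/-! ### The Markov chain of collected sets and its expected completion time -/

section Chain

variable {L : ℕ} {Ω : Type*} [MeasurableSpace Ω] {P : Measure Ω} {a : ℝ}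
  {α : ℕ → Fin L → Ω → ℝ} {m : Finset (Fin L) → Fin L → ℝ}

theorem measurable_nodes (h : IsFrechetFamily a P α) :
    Measurable fun ω (j : ℕ) (l : Fin L) => α j l ω :=
  measurable_pi_lambda _ fun j => measurable_pi_lambda _ fun l => h.measurable j l

theorem IsFrechetFamily.iIndepFun_node (h : IsFrechetFamily a P α) (n : ℕ) :
    iIndepFun (α n) P :=
  h.indep.precomp (g := fun l => (n, l)) (Prod.mk_right_injective n)

variable [IsProbabilityMeasure P]

theorem IsFrechetFamily.ae_pos (h : IsFrechetFamily a P α) (ha : 0 < a) :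
    ∀ᵐ ω ∂P, ∀ j l, 0 < α j l ω := by
  rw [ae_all_iff]
  intro j
  rw [ae_all_iff]
  intro l
  rw [ae_iff]
  simpa using frechet_le_of_nonpos ha (h.cdf j l)

theorem IsFrechetFamily.ae_exists_dominant (h : IsFrechetFamily a P α) (ha : 0 < a) (hL : 0 < L)
    (hm : ∀ S k, 0 < m S k) :
    ∀ᵐ ω ∂P, ∀ j S, ∃ l, IsDominant (m S) (fun k => α j k ω) l := by
  rw [ae_all_iff]
  intro j
  rw [ae_all_iff]
  intro S
  exact ae_exists_isDominant hL ha (h.measurable j) (h.iIndepFun_node j) (h.cdf j) (hm S)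

theorem IsFrechetFamily.ae_exists_dominant_compl (h : IsFrechetFamily a P α) (ha : 0 < a)
    {μ : Fin L → ℝ} (hμ : ∀ k, 0 < μ k) :
    ∀ᵐ ω ∂P, ∀ j, ∀ S : Finset (Fin L), S ≠ Finset.univ →
      ∃ l ∉ S, ∀ k ∉ S, k ≠ l → μ k * α j k ω < μ l * α j l ω := by
  rw [ae_all_iff]
  intro j
  rw [ae_all_iff]
  intro S
  by_cases hS : S = Finset.univ
  · exact Eventually.of_forall fun _ h => absurd hS h
  have hcard : 0 < Sᶜ.card := Finset.card_pos.2
    (Finset.nonempty_iff_ne_empty.2 fun h => hS (Finset.compl_eq_empty_iff S |>.1 h))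
  -- Enumerating the complement turns it into a full Fréchet family with fewer modes, to which
  -- almost sure dominance applies.
  set e := Sᶜ.orderEmbOfFin rfl with he
  have hrange : ∀ k, k ∉ S → ∃ i, e i = k := fun k hk => by
    have : k ∈ Set.range e := by
      rw [he, Finset.range_orderEmbOfFin]
      simpa using hk
    exact this
  have hdom := ae_exists_isDominant hcard ha (fun i => h.measurable j (e i))
    ((h.iIndepFun_node j).precomp e.injective) (fun i => h.cdf j (e i)) (m := fun i => μ (e i))
    fun i => hμ _
  filter_upwards [hdom] with ω hω _
  obtain ⟨i, hi⟩ := hω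
  refine ⟨e i, Finset.mem_compl.1 (Finset.orderEmbOfFin_mem Sᶜ rfl i), fun k hk hkl => ?_⟩
  obtain ⟨i', rfl⟩ := hrange k hk
  exact hi i' fun h => hkl (by rw [h])

/-- Markov property: the set reached after `n` nodes depends only on earlier coefficients, which are
independent of node `n`. -/
theorem measure_process_inter_dominant (h : IsFrechetFamily a P α) (ha : 0 < a)
    (hm : ∀ S k, 0 < m S k) (n : ℕ) (S : Finset (Fin L)) (l : Fin L) :
    P.real ({ω | dominantProcess m (fun j k => α j k ω) n = S} ∩
      {ω | IsDominant (m S) (fun k => α n k ω) l}) =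
    P.real {ω | dominantProcess m (fun j k => α j k ω) n = S} * modeProb (m S) a l := by
  classical
  set A : Finset (ℕ × Fin L) := Finset.range n ×ˢ Finset.univ with hA
  set B : Finset (ℕ × Fin L) := {n} ×ˢ Finset.univ with hB
  have hind := h.indep.indepFun_finset A B (by
    rw [Finset.disjoint_left]
    rintro ⟨j, k⟩ h1 h2
    simp [hA] at h1
    simp [hB] at h2
    omega) fun i => h.measurable i.1 i.2
  set φ : (A → ℝ) → ℕ → Fin L → ℝ := fun u j k => if hjk : (j, k) ∈ A then u ⟨_, hjk⟩ else 0 with hφ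
  have hφm : Measurable φ := by
    refine measurable_pi_lambda _ fun j => measurable_pi_lambda _ fun k => ?_
    simp only [hφ]
    split_ifs
    · exact measurable_pi_apply _
    · exact measurable_const
  set ψ : (B → ℝ) → Fin L → ℝ := fun u k => u ⟨(n, k), by simp [hB]⟩ with hψ
  have hψm : Measurable ψ := measurable_pi_lambda _ fun k => measurable_pi_apply _
  have h1 : {ω | dominantProcess m (fun j k => α j k ω) n = S} =
      (fun ω (i : A) => α i.1.1 i.1.2 ω) ⁻¹' (φ ⁻¹' {x | dominantProcess m x n = S}) := by
    ext ω
    simp only [Set.mem_ofPred_eq, Set.mem_preimage]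
    rw [dominantProcess_congr (x' := φ fun i : A => α i.1.1 i.1.2 ω)]
    intro j hj
    ext k
    simp [hφ, hA, hj]
  have h2 : {ω | IsDominant (m S) (fun k => α n k ω) l} =
      (fun ω (i : B) => α i.1.1 i.1.2 ω) ⁻¹' (ψ ⁻¹' {x | IsDominant (m S) x l}) := rfl
  have h3 : P {ω | IsDominant (m S) (fun k => α n k ω) l} =
      ENNReal.ofReal (modeProb (m S) a l) :=
    measure_isDominant ha (h.measurable n) (h.iIndepFun_node n) (h.cdf n) (hm S) l
  have h4 := hind.measure_inter_preimage_eq_mul _ _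
    (hφm (measurableSet_dominantProcess (m := m) n S)) (hψm (measurableSet_isDominant (m S) l))
  rw [← h1, ← h2, h3] at h4
  rw [measureReal_def, h4, ENNReal.toReal_mul,
    ENNReal.toReal_ofReal (modeProb_pos (hm S) a l).le, measureReal_def]

theorem sum_process_measure (h : IsFrechetFamily a P α) (n : ℕ) (A : Finset (Finset (Fin L))) :
    ∑ S ∈ A, P.real {ω | dominantProcess m (fun j k => α j k ω) n = S} =
      P.real {ω | dominantProcess m (fun j k => α j k ω) n ∈ A} := by
  have h1 : {ω | dominantProcess m (fun j k => α j k ω) n ∈ A} =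
      ⋃ S ∈ A, {ω | dominantProcess m (fun j k => α j k ω) n = S} := by
    ext ω
    simp
  rw [h1, measureReal_biUnion_finset]
  · refine fun S _ T _ hST => Set.disjoint_left.2 fun ω hS hT => hST ?_
    exact Eq.trans (Eq.symm (Set.mem_ofPred.1 hS)) (Set.mem_ofPred.1 hT)
  · exact fun S _ => measurable_nodes h (measurableSet_dominantProcess n S)

theorem process_measure_succ (h : IsFrechetFamily a P α) (ha : 0 < a) (hL : 0 < L)
    (hm : ∀ S k, 0 < m S k) (n : ℕ) (B : Finset (Fin L)) :
    P.real {ω | dominantProcess m (fun j k => α j k ω) (n + 1) = B} =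
      ∑ p : Finset (Fin L) × Fin L with insert p.2 p.1 = B,
        P.real {ω | dominantProcess m (fun j k => α j k ω) n = p.1} *
          modeProb (m p.1) a p.2 := by
  simp_rw [← measure_process_inter_dominant h ha hm]
  rw [← measureReal_biUnion_finset]
  · refine measureReal_congr ?_
    filter_upwards [h.ae_exists_dominant ha hL hm] with ω hω
    refine propext ?_
    change dominantProcess m (fun j k => α j k ω) (n + 1) = B ↔ ω ∈ ⋃ p ∈ _, _
    simp only [Set.mem_iUnion, Finset.mem_filter, Finset.mem_univ, true_and, exists_prop]
    constructor
    · intro hB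
      obtain ⟨l, hl⟩ := hω n (dominantProcess m (fun j k => α j k ω) n)
      exact ⟨(_, l), (dominantProcess_succ hl).symm.trans hB, rfl, hl⟩
    · rintro ⟨⟨S, l⟩, hS, h1, h2⟩
      have h1' : dominantProcess m (fun j k => α j k ω) n = S := h1
      have h2' : IsDominant (m S) (fun k => α n k ω) l := h2
      rw [dominantProcess_succ (l := l) (by rw [h1']; exact h2'), h1']
      exact hS
  · rintro ⟨S, l⟩ _ ⟨T, k⟩ _ hne
    refine Set.disjoint_left.2 ?_
    rintro ω ⟨h1, h2⟩ ⟨h3, h4⟩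
    have h5 : S = T := by
      have h1' : dominantProcess m (fun j k => α j k ω) n = S := h1
      have h3' : dominantProcess m (fun j k => α j k ω) n = T := h3
      exact h1'.symm.trans h3'
    subst h5
    have h2' : IsDominant (m S) (fun k => α n k ω) l := h2
    exact hne (by rw [h2'.unique h4])
  · intro p _
    refine (measurable_nodes h (measurableSet_dominantProcess n p.1)).inter ?_
    exact (measurable_pi_lambda (fun ω k => α n k ω) fun k => h.measurable n k)
      (measurableSet_isDominant (m p.1) p.2)

/-- `W` solves the equations of the expected number of further nodes. -/
structure IsExpectedRemaining {L : ℕ} (m : Finset (Fin L) → Fin L → ℝ) (a : ℝ)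
    (W : Finset (Fin L) → ℝ) : Prop where
  univ : W Finset.univ = 0
  nonneg : ∀ S, 0 ≤ W S
  step : ∀ S, S ≠ Finset.univ → W S = 1 + ∑ l, modeProb (m S) a l * W (insert l S)

/-- The mean `E n` of `W` at the set reached after `n` nodes drops at each step by exactly `q n`,
the probability of being incomplete, so the sum telescopes. Boundedness makes `q` summable, hence `q
n → 0`, and `E n ≤ (∑ W) * q n` leaves no remainder. -/
theorem hasSum_process_measure (h : IsFrechetFamily a P α) (ha : 0 < a) (hL : 0 < L)
    (hm : ∀ S k, 0 < m S k) {W : Finset (Fin L) → ℝ} (hW : IsExpectedRemaining m a W) :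
    HasSum (fun n => P.real {ω | dominantProcess m (fun j k => α j k ω) n ≠ Finset.univ}) (W ∅) := by
  set π : ℕ → Finset (Fin L) → ℝ := fun n S =>
    P.real {ω | dominantProcess m (fun j k => α j k ω) n = S} with hπ
  set q : ℕ → ℝ := fun n =>
    P.real {ω | dominantProcess m (fun j k => α j k ω) n ≠ Finset.univ} with hq
  set E : ℕ → ℝ := fun n => ∑ S, π n S * W S with hE
  have hqsum : ∀ n, q n = ∑ S ∈ Finset.univ.erase Finset.univ, π n S := by
    intro n
    rw [hπ, sum_process_measure h]
    simp [hq]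
  have hEsucc : ∀ n, E (n + 1) = E n - q n := by
    intro n
    have h1 : E (n + 1) = ∑ p : Finset (Fin L) × Fin L,
        π n p.1 * modeProb (m p.1) a p.2 * W (insert p.2 p.1) := by
      rw [← Finset.sum_fiberwise Finset.univ (fun p : Finset (Fin L) × Fin L => insert p.2 p.1)]
      refine Finset.sum_congr rfl fun B _ => ?_
      simp only [hπ]
      rw [process_measure_succ h ha hL hm, Finset.sum_mul]
      refine Finset.sum_congr rfl fun p hp => ?_
      rw [(Finset.mem_filter.1 hp).2]
    rw [h1, Fintype.sum_prod_type, hqsum, hE]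
    simp only
    rw [← Finset.add_sum_erase _ _ (Finset.mem_univ (Finset.univ : Finset (Fin L))),
      ← Finset.add_sum_erase _ (fun S => π n S * W S)
        (Finset.mem_univ (Finset.univ : Finset (Fin L))), hW.univ]
    have h2 : ∑ l, π n Finset.univ * modeProb (m Finset.univ) a l * W (insert l Finset.univ) = 0 :=
      Finset.sum_eq_zero fun l _ => by
        rw [Finset.insert_eq_of_mem (Finset.mem_univ l), hW.univ, mul_zero]
    rw [h2, mul_zero, zero_add, zero_add, ← Finset.sum_sub_distrib]
    refine Finset.sum_congr rfl fun S hS => ?_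
    rw [hW.step S (Finset.ne_of_mem_erase hS), mul_add, mul_one, add_sub_cancel_left,
      Finset.mul_sum]
    exact Finset.sum_congr rfl fun l _ => by ring
  have hπ0 : ∀ n S, 0 ≤ π n S := fun n S => measureReal_nonneg
  have hE0 : E 0 = W ∅ := by
    have h1 : ∀ S, π 0 S = if S = ∅ then 1 else 0 := by
      intro S
      simp only [hπ, dominantProcess]
      split_ifs with hS
      · simp [hS]
      · simp [Ne.symm hS]
    simp [hE, h1]
  have hEnn : ∀ n, 0 ≤ E n := fun n =>
    Finset.sum_nonneg fun S _ => mul_nonneg (hπ0 n S) (hW.nonneg S)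
  have hpartial : ∀ n, ∑ i ∈ Finset.range n, q i = W ∅ - E n := by
    intro n
    induction n with
    | zero => simp [hE0]
    | succ n ih => rw [Finset.sum_range_succ, ih, hEsucc]; ring
  have hqnn : ∀ n, 0 ≤ q n := fun n => measureReal_nonneg
  have hqs : Summable q := summable_of_sum_range_le hqnn fun n => by
    rw [hpartial]
    have := hEnn n
    exact sub_le_self _ this
  have hEle : ∀ n, E n ≤ (∑ S, W S) * q n := by
    intro n
    simp only [hE]
    rw [← Finset.add_sum_erase _ _ (Finset.mem_univ (Finset.univ : Finset (Fin L))), hW.univ,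
      mul_zero, zero_add, hqsum, Finset.mul_sum]
    refine Finset.sum_le_sum fun S _ => ?_
    rw [mul_comm]
    exact mul_le_mul_of_nonneg_right
      (Finset.single_le_sum (f := W) (fun T _ => hW.nonneg T) (Finset.mem_univ S)) (hπ0 n S)
  have hElim : Tendsto E atTop (𝓝 0) := by
    have := hqs.tendsto_atTop_zero.const_mul (∑ S, W S)
    rw [mul_zero] at this
    exact squeeze_zero hEnn hEle this
  rw [hasSum_iff_tendsto_nat_of_nonneg hqnn]
  simp_rw [hpartial]
  simpa using hElim.const_sub (W ∅)

theorem iInf_natCast_eq_tsum {p : ℕ → Prop} [DecidablePred p] (hp : ∀ n, p n → p (n + 1)) :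
    (((⨅ (n : ℕ) (_ : p n), (n : ℕ∞)) : ℕ∞) : ℝ≥0∞) = ∑' n, if p n then 0 else 1 := by
  by_cases hex : ∃ n, p n
  · have hmono : ∀ n k, n ≤ k → p n → p k := fun n k hnk h =>
      Nat.le_induction h (fun j _ => hp j) k hnk
    have h1 : (⨅ (n : ℕ) (_ : p n), (n : ℕ∞)) = (Nat.find hex : ℕ∞) :=
      le_antisymm (iInf₂_le _ (Nat.find_spec hex))
        (le_iInf₂ fun n hn => by exact_mod_cast Nat.find_min' hex hn)
    rw [h1, tsum_eq_sum (s := Finset.range (Nat.find hex)),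
      Finset.sum_congr rfl fun n hn => if_neg (Nat.find_min hex (Finset.mem_range.1 hn))]
    · simp
    · intro n hn
      rw [if_pos (hmono _ n (by simpa using hn) (Nat.find_spec hex))]
  · have h0 : ∀ n, ¬ p n := fun n hn => hex ⟨n, hn⟩
    have h1 : (⨅ (n : ℕ) (_ : p n), (n : ℕ∞)) = ⊤ := by
      simp [h0]
    rw [h1]
    simp [h0]

end Chain

/-! ### From trajectories to the chain -/

section Learning

variable {L d : ℕ} {ζ : Modes L d} {Ω : Type*} [MeasurableSpace Ω] {P : Measure Ω} {a : ℝ}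
  {α : ℕ → Fin L → Ω → ℝ} {m : Finset (Fin L) → Fin L → ℝ} {w : ℕ → Ω → ℝ → Weight d}

theorem collected_zero (v : ℕ → ℝ → Weight d) : collected ζ v 0 = ∅ := by
  simp [collected]

theorem collected_succ_of_tendsto {v : ℕ → ℝ → Weight d} {n : ℕ} {l : Fin L}
    (h : Tendsto (v n) atTop (𝓝 (ζ l))) :
    collected ζ v (n + 1) = insert l (collected ζ v n) := by
  ext k
  simp only [collected, Finset.mem_filter, Finset.mem_univ, true_and, Finset.mem_insert]
  constructor
  · rintro ⟨j, hj, hk⟩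
    rcases Nat.lt_succ_iff_lt_or_eq.1 hj with hj | rfl
    · exact Or.inr ⟨j, hj, hk⟩
    · exact Or.inl (ζ.orthonormal.linearIndependent.injective (tendsto_nhds_unique hk h))
  · rintro (rfl | ⟨j, hj, hk⟩)
    · exact ⟨n, n.lt_succ_self, h⟩
    · exact ⟨j, hj.trans n.lt_succ_self, hk⟩

theorem collected_mono (v : ℕ → ℝ → Weight d) {n k : ℕ} (h : n ≤ k) :
    collected ζ v n ⊆ collected ζ v k := by
  intro l hl
  simp only [collected, Finset.mem_filter, Finset.mem_univ, true_and] at hl ⊢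
  obtain ⟨j, hj, hl⟩ := hl
  exact ⟨j, hj.trans_le h, hl⟩

theorem card_collected_le (v : ℕ → ℝ → Weight d) (n : ℕ) : (collected ζ v n).card ≤ n := by
  induction n with
  | zero => simp [collected_zero]
  | succ n ih =>
    by_cases h : ∃ l, Tendsto (v n) atTop (𝓝 (ζ l))
    · obtain ⟨l, hl⟩ := h
      rw [collected_succ_of_tendsto hl]
      exact (Finset.card_insert_le _ _).trans (Nat.succ_le_succ ih)
    · have : collected ζ v (n + 1) ⊆ collected ζ v n := by
        intro k hk
        simp only [collected, Finset.mem_filter, Finset.mem_univ, true_and] at hk ⊢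
        obtain ⟨j, hj, hk⟩ := hk
        rcases Nat.lt_succ_iff_lt_or_eq.1 hj with hj | rfl
        · exact ⟨j, hj, hk⟩
        · exact absurd ⟨k, hk⟩ h
      exact (Finset.card_le_card this).trans (ih.trans n.le_succ)

theorem le_nodesNeeded (ζ : Modes L d) (v : ℕ → ℝ → Weight d) : (L : ℕ∞) ≤ nodesNeeded ζ v := by
  refine le_iInf₂ fun n hn => ?_
  have := card_collected_le (ζ := ζ) v n
  rw [hn, Finset.card_univ, Fintype.card_fin] at this
  exact_mod_cast this

theorem le_expectedNodes (ζ : Modes L d) [IsProbabilityMeasure P] (w : ℕ → Ω → ℝ → Weight d) :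
    (L : ℝ≥0∞) ≤ expectedNodes ζ P w := by
  calc (L : ℝ≥0∞) = ∫⁻ _, (L : ℝ≥0∞) ∂P := by simp
    _ ≤ _ := lintegral_mono fun ω => by
      have := ENat.toENNReal_mono (le_nodesNeeded ζ fun j => w j ω)
      simpa using this

/-- Almost surely, the modes collected by the gradient dynamics are the dominant ones. -/
theorem ae_collected_eq_process [IsProbabilityMeasure P] (h : IsFrechetFamily a P α) (ha : 0 < a)
    (hL : 0 < L) (hm : ∀ S k, 0 < m S k)
    (hw : IsSequentialLearning ζ (fun S => gradientRule ζ (m S)) P α w) :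
    ∀ᵐ ω ∂P, ∀ n, collected ζ (fun j => w j ω) n = dominantProcess m (fun j k => α j k ω) n := by
  filter_upwards [hw, h.ae_pos ha, h.ae_exists_dominant ha hL hm] with ω hω hpos hdom n
  induction n with
  | zero => simp [collected_zero, dominantProcess]
  | succ n ih =>
    obtain ⟨l, hl⟩ := hdom n (collected ζ (fun j => w j ω) n)
    rw [collected_succ_of_tendsto (tendsto_of_gradientRule (hm _) (hpos n) hl (hω n)), ih,
      dominantProcess_succ (ih ▸ hl)]

/-- Tail-sum formula. No measurability of the trajectories is assumed: the integrand is first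
replaced almost everywhere by one built from the measurable process. -/
theorem expectedNodes_eq [IsProbabilityMeasure P] (h : IsFrechetFamily a P α) (ha : 0 < a)
    (hL : 0 < L) (hm : ∀ S k, 0 < m S k)
    (hw : IsSequentialLearning ζ (fun S => gradientRule ζ (m S)) P α w)
    {W : Finset (Fin L) → ℝ} (hW : IsExpectedRemaining m a W) :
    expectedNodes ζ P w = ENNReal.ofReal (W ∅) := by
  classical
  have h1 : expectedNodes ζ P w = ∫⁻ ω, ∑' n,
      {ω | dominantProcess m (fun j k => α j k ω) n ≠ Finset.univ}.indicator 1 ω ∂P := by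
    refine lintegral_congr_ae ?_
    filter_upwards [ae_collected_eq_process h ha hL hm hw] with ω hω
    rw [nodesNeeded, iInf_natCast_eq_tsum fun n hn => Finset.univ_subset_iff.1
      (hn ▸ collected_mono _ n.le_succ)]
    refine tsum_congr fun n => ?_
    rw [hω n, Set.indicator_apply]
    simp only [Set.mem_ofPred_eq, Pi.one_apply, ite_not]
  have hmeas : ∀ n, MeasurableSet
      {ω | dominantProcess m (fun j k => α j k ω) n ≠ Finset.univ} := fun n =>
    (measurable_nodes h (measurableSet_dominantProcess n Finset.univ)).compl
  have hsum := hasSum_process_measure h ha hL hm hW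
  rw [h1, lintegral_tsum fun n => (measurable_one.indicator (hmeas n)).aemeasurable,
    ← hsum.tsum_eq, ENNReal.ofReal_tsum_of_nonneg (fun n => measureReal_nonneg) hsum.summable]
  refine tsum_congr fun n => ?_
  rw [lintegral_indicator_one (hmeas n), ofReal_measureReal]

theorem measure_tendsto_mode [IsProbabilityMeasure P] (h : IsFrechetFamily a P α) (ha : 0 < a)
    (hL : 0 < L) {μ : Fin L → ℝ} (hμ : ∀ k, 0 < μ k) (hw : IsIndependentLearning ζ μ P α w)
    (j : ℕ) (l : Fin L) :
    P {ω | Tendsto (w j ω) atTop (𝓝 (ζ l))} = ENNReal.ofReal (modeProb μ a l) := by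
  rw [← measure_isDominant ha (h.measurable j) (h.iIndepFun_node j) (h.cdf j) hμ l]
  refine measure_congr ?_
  filter_upwards [hw, h.ae_pos ha, h.ae_exists_dominant (m := fun _ => μ) ha hL fun _ => hμ]
    with ω hω hpos hdom
  obtain ⟨k, hk⟩ := hdom j ∅
  have hlim := tendsto_of_gradientRule hμ (hpos j) hk (hω j)
  refine propext ⟨fun ht => ?_, fun hd => ?_⟩
  · have : l = k := ζ.orthonormal.linearIndependent.injective (tendsto_nhds_unique ht hlim)
    exact this ▸ hk
  · have : k = l := hk.unique hd
    exact this ▸ hlim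

/-- With the Muon update, every node converges to a mode that has not been collected before. -/
theorem expectedNodes_muon [IsProbabilityMeasure P] (h : IsFrechetFamily a P α) (ha : 0 < a)
    {μ : Fin L → ℝ} (hμ : ∀ k, 0 < μ k) (hμ1 : ∀ k, μ k ≤ 1)
    (hw : IsSequentialLearning ζ (muonRule ζ μ) P α w) : expectedNodes ζ P w = L := by
  classical
  refine le_antisymm ?_ (le_expectedNodes ζ w)
  calc expectedNodes ζ P w ≤ ∫⁻ _, (L : ℝ≥0∞) ∂P := lintegral_mono_ae ?_
    _ = L := by simp
  filter_upwards [hw, h.ae_pos ha, h.ae_exists_dominant_compl ha hμ] with ω hω hpos hdom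
  have hcard : ∀ n ≤ L, (collected ζ (fun j => w j ω) n).card = n := by
    intro n hn
    induction n with
    | zero => simp [collected_zero]
    | succ n ih =>
      have ih := ih (by omega)
      obtain ⟨l, hlS, hl⟩ := hdom n (collected ζ (fun j => w j ω) n) fun hu => by
        rw [hu, Finset.card_univ, Fintype.card_fin] at ih
        omega
      rw [collected_succ_of_tendsto (tendsto_of_muonRule hμ hμ1 (hpos n) hlS hl (hω n)),
        Finset.card_insert_of_notMem hlS, ih]
  have hle : nodesNeeded ζ (fun j => w j ω) ≤ (L : ℕ∞) := iInf₂_le L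
    ((Finset.card_eq_iff_eq_univ _).1 (by rw [hcard L le_rfl, Fintype.card_fin]))
  have := ENat.toENNReal_mono hle
  simpa using this

end Learning


/-! ### The expected number of nodes -/

section Remaining

variable {L : ℕ}

theorem sum_insert_split (p : Fin L → ℝ) (W : Finset (Fin L) → ℝ) (S : Finset (Fin L)) :
    ∑ l, p l * W (insert l S) = (∑ l ∈ S, p l) * W S + ∑ l ∈ Sᶜ, p l * W (insert l S) := by
  rw [← Finset.sum_add_sum_compl S, Finset.sum_mul]
  congr 1
  exact Finset.sum_congr rfl fun l hl => by rw [Finset.insert_eq_of_mem hl]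

theorem compl_nonempty_of_ne_univ {S : Finset (Fin L)} (hS : S ≠ Finset.univ) : Sᶜ.Nonempty :=
  Finset.nonempty_iff_ne_empty.2 fun h => hS ((Finset.compl_eq_empty_iff S).1 h)

theorem card_compl_insert {S : Finset (Fin L)} {l : Fin L} (hl : l ∈ Sᶜ) :
    (insert l S)ᶜ.card + 1 = Sᶜ.card := by
  rw [Finset.compl_insert, Finset.card_erase_add_one hl]

theorem sum_compl_insert {S : Finset (Fin L)} {l : Fin L} (hl : l ∈ Sᶜ) (f : Fin L → ℝ) :
    ∑ k ∈ (insert l S)ᶜ, f k = ∑ k ∈ Sᶜ, f k - f l := by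
  rw [Finset.compl_insert, ← Finset.add_sum_erase _ f hl, add_sub_cancel_left]

/-- A repeated draw leaves `S` unchanged, so its term moves to the left and only missing modes
remain. -/
theorem IsExpectedRemaining.of_compl (hL : 0 < L) {m : Finset (Fin L) → Fin L → ℝ} {a : ℝ}
    (hm : ∀ S k, 0 < m S k) {W : Finset (Fin L) → ℝ} (h0 : W Finset.univ = 0) (hn : ∀ S, 0 ≤ W S)
    (h : ∀ S, S ≠ Finset.univ → (∑ l ∈ Sᶜ, modeProb (m S) a l) * W S =
      1 + ∑ l ∈ Sᶜ, modeProb (m S) a l * W (insert l S)) : IsExpectedRemaining m a W := by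
  refine ⟨h0, hn, fun S hS => ?_⟩
  have h1 := sum_modeProb hL (hm S) a
  rw [← Finset.sum_add_sum_compl S] at h1
  rw [sum_insert_split]
  linear_combination h S hS - W S * h1

/-- The expected remaining time by recursion on the number of missing indices. -/
def remainingAux (p : Fin L → ℝ) : ℕ → Finset (Fin L) → ℝ
  | 0, _ => 0
  | n + 1, S => (1 + ∑ l ∈ Sᶜ, p l * remainingAux p n (insert l S)) / ∑ l ∈ Sᶜ, p l

/-- The expected number of draws, distributed according to `p`, that complete the set `S`. -/
def remaining (p : Fin L → ℝ) (S : Finset (Fin L)) : ℝ := remainingAux p Sᶜ.card S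

theorem remaining_univ (p : Fin L → ℝ) : remaining p Finset.univ = 0 := by
  simp [remaining, remainingAux]

theorem remaining_nonneg {p : Fin L → ℝ} (hp : ∀ l, 0 < p l) (S : Finset (Fin L)) :
    0 ≤ remaining p S := by
  have : ∀ n S, 0 ≤ remainingAux p n S := by
    intro n
    induction n with
    | zero => exact fun _ => le_rfl
    | succ n ih =>
      exact fun S => div_nonneg (add_nonneg zero_le_one
        (Finset.sum_nonneg fun l _ => mul_nonneg (hp l).le (ih _)))
        (Finset.sum_nonneg fun l _ => (hp l).le)
  exact this _ _

theorem remaining_step {p : Fin L → ℝ} (hp : ∀ l, 0 < p l) {S : Finset (Fin L)}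
    (hS : S ≠ Finset.univ) :
    (∑ l ∈ Sᶜ, p l) * remaining p S = 1 + ∑ l ∈ Sᶜ, p l * remaining p (insert l S) := by
  have hne := compl_nonempty_of_ne_univ hS
  obtain ⟨n, hn⟩ := Nat.exists_eq_succ_of_ne_zero (Finset.card_pos.2 hne).ne'
  have h1 : ∑ l ∈ Sᶜ, p l * remaining p (insert l S) =
      ∑ l ∈ Sᶜ, p l * remainingAux p n (insert l S) := by
    refine Finset.sum_congr rfl fun l hl => ?_
    have := card_compl_insert hl
    rw [remaining, show (insert l S)ᶜ.card = n by omega]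
  rw [h1, remaining, hn, Nat.succ_eq_add_one, remainingAux]
  exact mul_div_cancel₀ _ (Finset.sum_pos (fun l _ => hp l) hne).ne'

/-- Comparison principle, by induction on the number of missing modes: a subsolution lies below a
supersolution. -/
theorem le_of_remaining_le {p : Fin L → ℝ} (hp : ∀ l, 0 < p l) {V W : Finset (Fin L) → ℝ}
    (h0 : V Finset.univ ≤ W Finset.univ)
    (h : ∀ S, S ≠ Finset.univ → (∑ l ∈ Sᶜ, p l) * V S - ∑ l ∈ Sᶜ, p l * V (insert l S) ≤
      (∑ l ∈ Sᶜ, p l) * W S - ∑ l ∈ Sᶜ, p l * W (insert l S)) (S : Finset (Fin L)) :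
    V S ≤ W S := by
  induction hn : Sᶜ.card generalizing S with
  | zero =>
    rw [Finset.card_eq_zero, Finset.compl_eq_empty_iff] at hn
    rw [hn]; exact h0
  | succ n ih =>
    have hS : S ≠ Finset.univ := by
      rintro rfl
      simp at hn
    have h1 : ∑ l ∈ Sᶜ, p l * V (insert l S) ≤ ∑ l ∈ Sᶜ, p l * W (insert l S) := by
      refine Finset.sum_le_sum fun l hl => mul_le_mul_of_nonneg_left (ih _ ?_) (hp l).le
      have := card_compl_insert hl
      omega
    have h2 : (∑ l ∈ Sᶜ, p l) * V S ≤ (∑ l ∈ Sᶜ, p l) * W S := by linarith [h S hS]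
    exact le_of_mul_le_mul_left h2
      (Finset.sum_pos (fun l _ => hp l) (compl_nonempty_of_ne_univ hS))

theorem remaining_diff {p : Fin L → ℝ} (hp : ∀ l, 0 < p l) {S : Finset (Fin L)}
    (hS : S ≠ Finset.univ) :
    (∑ l ∈ Sᶜ, p l) * remaining p S - ∑ l ∈ Sᶜ, p l * remaining p (insert l S) = 1 := by
  rw [remaining_step hp hS]; ring

/-- The subsolution is the mean wait for the single mode `k`. -/
theorem inv_le_remaining {p : Fin L → ℝ} (hp : ∀ l, 0 < p l) (k : Fin L) :
    1 / p k ≤ remaining p ∅ := by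
  have hk := hp k
  have := le_of_remaining_le hp (V := fun S => if k ∈ S then 0 else 1 / p k) (W := remaining p)
    (by simp [remaining_univ]) (fun S hS => ?_) ∅
  · simpa using this
  rw [remaining_diff hp hS]
  by_cases hkS : k ∈ S
  · simp [hkS]
  · have hkc : k ∈ Sᶜ := Finset.mem_compl.2 hkS
    have h1 : ∑ l ∈ Sᶜ, p l * (if k ∈ insert l S then 0 else 1 / p k) =
        (∑ l ∈ Sᶜ, p l - p k) * (1 / p k) := by
      rw [← Finset.add_sum_erase _ _ hkc, ← Finset.add_sum_erase _ p hkc, add_sub_cancel_left,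
        Finset.sum_mul]
      simp only [Finset.mem_insert_self, if_true, mul_zero, zero_add]
      refine Finset.sum_congr rfl fun l hl => ?_
      rw [if_neg]
      simp [hkS, (Finset.ne_of_mem_erase hl).symm]
    simp only [if_neg hkS]
    rw [h1]
    field_simp
    linarith

/-- The supersolution adds the mean waits of all missing modes. -/
theorem remaining_le_sum_inv {p : Fin L → ℝ} (hp : ∀ l, 0 < p l) :
    remaining p ∅ ≤ ∑ l, 1 / p l := by
  have := le_of_remaining_le hp (V := remaining p) (W := fun S => ∑ l ∈ Sᶜ, 1 / p l)
    (by simp [remaining_univ]) (fun S hS => ?_) ∅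
  · simpa using this
  rw [remaining_diff hp hS]
  have h1 : ∑ l ∈ Sᶜ, p l * ∑ k ∈ (insert l S)ᶜ, 1 / p k =
      (∑ l ∈ Sᶜ, p l) * (∑ l ∈ Sᶜ, 1 / p l) - Sᶜ.card := by
    rw [Finset.sum_mul, Finset.card_eq_sum_ones, Nat.cast_sum, ← Finset.sum_sub_distrib]
    refine Finset.sum_congr rfl fun l hl => ?_
    rw [sum_compl_insert hl, mul_sub, mul_one_div_cancel (hp l).ne']
    simp
  rw [h1, sub_sub_cancel]
  exact_mod_cast Finset.card_pos.2 (compl_nonempty_of_ne_univ hS)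

theorem sum_div_sub_ge {R : Finset (Fin L)} {p : Fin L → ℝ} (hp : ∀ l, 0 < p l) {n : ℕ}
    (hn : 0 < n) (hR : R.card = n + 1) :
    ((n : ℝ) + 1) / n ≤ ∑ l ∈ R, p l / (∑ k ∈ R, p k - p l) := by
  set Q := ∑ k ∈ R, p k with hQ
  have hn' : (0 : ℝ) < n := by exact_mod_cast hn
  have hQ0 : 0 < Q := Finset.sum_pos (fun l _ => hp l) (Finset.card_pos.1 (by omega))
  set c : ℝ := ((n : ℝ) + 1) / n with hc
  have hlt : ∀ l ∈ R, 0 < Q - p l := by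
    intro l hl
    rw [hQ, ← Finset.add_sum_erase _ _ hl, add_sub_cancel_left]
    refine Finset.sum_pos (fun l _ => hp l) (Finset.card_pos.1 ?_)
    rw [Finset.card_erase_of_mem hl]; omega
  -- Jensen by a tangent line: `p/(Q-p) = 1/u - 1` with `u = 1 - p/Q`, and the mean of `u` over `R`
  -- is `n/(n+1) = 1/c`.
  have htan : ∀ l ∈ R, 2 * c - c ^ 2 * (1 - p l / Q) - 1 ≤ p l / (Q - p l) := by
    intro l hl
    have h1 := hlt l hl
    have h2 : p l / (Q - p l) - (2 * c - c ^ 2 * (1 - p l / Q) - 1) =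
        (Q - c * (Q - p l)) ^ 2 / (Q * (Q - p l)) := by
      field_simp
      ring
    have h3 : 0 ≤ (Q - c * (Q - p l)) ^ 2 / (Q * (Q - p l)) := by positivity
    linarith
  refine le_trans (le_of_eq ?_) (Finset.sum_le_sum htan)
  have h4 : ∑ l ∈ R, p l / Q = 1 := by rw [← Finset.sum_div]; exact div_self hQ0.ne'
  have h5 : ∀ l, 2 * c - c ^ 2 * (1 - p l / Q) - 1 = 2 * c - c ^ 2 - 1 + c ^ 2 * (p l / Q) :=
    fun l => by ring
  simp_rw [h5]
  rw [Finset.sum_add_distrib, ← Finset.mul_sum, h4, Finset.sum_const, hR, nsmul_eq_mul]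
  push_cast
  rw [hc]
  field_simp
  ring

theorem harmonic_le_remaining {p : Fin L → ℝ} (hp : ∀ l, 0 < p l) (hsum : ∑ l, p l = 1) :
    L * ∑ l ∈ Finset.Icc 1 L, 1 / (l : ℝ) ≤ remaining p ∅ := by
  set H : ℕ → ℝ := fun n => ∑ l ∈ Finset.Icc 1 n, 1 / (l : ℝ) with hH
  have hHnn : ∀ n, 0 ≤ H n := fun n => Finset.sum_nonneg fun _ _ => by positivity
  -- The subsolution is the expected time if the missing mass were spread equally over the missing
  -- modes; convexity makes unequal masses slower.
  have := le_of_remaining_le hp (V := fun S => Sᶜ.card * H Sᶜ.card / ∑ l ∈ Sᶜ, p l)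
    (W := remaining p) (by simp [remaining_univ]) (fun S hS => ?_) ∅
  · simp only [Finset.compl_empty, Finset.card_univ, Fintype.card_fin, hsum, div_one] at this
    exact this
  rw [remaining_diff hp hS]
  have hne := compl_nonempty_of_ne_univ hS
  have hQ : 0 < ∑ l ∈ Sᶜ, p l := Finset.sum_pos (fun l _ => hp l) hne
  obtain ⟨n, hn⟩ := Nat.exists_eq_succ_of_ne_zero (Finset.card_pos.2 hne).ne'
  have h1 : ∑ l ∈ Sᶜ, p l * (((insert l S)ᶜ.card : ℝ) * H (insert l S)ᶜ.card /
      ∑ k ∈ (insert l S)ᶜ, p k) = n * H n * ∑ l ∈ Sᶜ, p l / (∑ k ∈ Sᶜ, p k - p l) := by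
    rw [Finset.mul_sum]
    refine Finset.sum_congr rfl fun l hl => ?_
    have := card_compl_insert hl
    rw [show (insert l S)ᶜ.card = n by omega, sum_compl_insert hl]
    ring
  have h2 : H (n + 1) = H n + 1 / ((n : ℝ) + 1) := by
    simp only [hH]
    rw [Finset.sum_Icc_succ_top (by omega)]
    push_cast
    rfl
  rw [h1, hn, Nat.succ_eq_add_one, mul_div_cancel₀ _ hQ.ne', h2]
  push_cast
  have hn1 : ((n : ℝ) + 1) * (H n + 1 / ((n : ℝ) + 1)) = (n + 1) * H n + 1 := by
    field_simp
  rw [hn1]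
  suffices h : ((n : ℝ) + 1) * H n ≤ n * H n * ∑ l ∈ Sᶜ, p l / (∑ k ∈ Sᶜ, p k - p l) by linarith
  -- With one missing mode the denominator vanishes, but `H 0 = 0` removes the term.
  rcases Nat.eq_zero_or_pos n with rfl | hnpos
  · simp [hH]
  have hn' : (0 : ℝ) < n := by exact_mod_cast hnpos
  calc ((n : ℝ) + 1) * H n = n * H n * (((n : ℝ) + 1) / n) := by field_simp
    _ ≤ _ := mul_le_mul_of_nonneg_left (sum_div_sub_ge hp hnpos hn)
      (mul_nonneg hn'.le (hHnn n))

theorem isExpectedRemaining_const (hL : 0 < L) {μ : Fin L → ℝ} (hμ : ∀ k, 0 < μ k) (a : ℝ) :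
    IsExpectedRemaining (fun _ => μ) a (remaining (modeProb μ a)) :=
  .of_compl hL (fun _ => hμ) (remaining_univ _) (remaining_nonneg (modeProb_pos hμ a))
    fun _ hS => remaining_step (modeProb_pos hμ a) hS

/-- Discounting the collected modes by one half only rescales the time spent at each set. -/
theorem isExpectedRemaining_half (hL : 0 < L) {μ : Fin L → ℝ} (hμ : ∀ k, 0 < μ k) {a : ℝ}
    (ha : 0 < a) :
    IsExpectedRemaining (fun S l => if l ∈ S then μ l / 2 else μ l) a fun S =>
      2 ^ (-a) * remaining (modeProb μ a) S + (1 - 2 ^ (-a)) * Sᶜ.card := by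
  set β : ℝ := 2 ^ (-a) with hβ
  have hβ0 : 0 < β := by positivity
  have hβ1 : β ≤ 1 := Real.rpow_le_one_of_one_le_of_nonpos (by norm_num) (by linarith)
  set p := modeProb μ a with hp
  have hp0 : ∀ l, 0 < p l := modeProb_pos hμ a
  have hpsum : ∑ l, p l = 1 := sum_modeProb hL hμ a
  refine .of_compl hL (fun S k => ?_) (by simp [remaining_univ]) (fun S => ?_) fun S hS => ?_
  · have := hμ k
    split_ifs <;> positivity
  · have := remaining_nonneg hp0 S
    have := sub_nonneg.2 hβ1
    positivity
  set Q := ∑ l ∈ Sᶜ, p l with hQ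
  set Z := β + (1 - β) * Q with hZ
  have hQ0 : 0 < Q := Finset.sum_pos (fun l _ => hp0 l) (compl_nonempty_of_ne_univ hS)
  have hZ0 : 0 < Z := by
    have := sub_nonneg.2 hβ1
    positivity
  have hprob : ∀ l ∈ Sᶜ, modeProb (fun l => if l ∈ S then μ l / 2 else μ l) a l = p l / Z := by
    intro l hl
    set T := ∑ k, μ k ^ a with hT
    have hT0 : 0 < T := Finset.sum_pos (fun k _ => Real.rpow_pos_of_pos (hμ k) a)
      ⟨l, Finset.mem_univ l⟩
    have hμp : ∀ k, μ k ^ a = T * p k := fun k => by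
      change μ k ^ a = T * (μ k ^ a / T)
      field_simp
    have h1 : ∑ k, (if k ∈ S then μ k / 2 else μ k) ^ a = T * Z := by
      rw [← Finset.sum_add_sum_compl S]
      have hS1 : ∑ k ∈ S, (if k ∈ S then μ k / 2 else μ k) ^ a = T * β * ∑ k ∈ S, p k := by
        rw [Finset.mul_sum]
        refine Finset.sum_congr rfl fun k hk => ?_
        rw [if_pos hk, Real.div_rpow (hμ k).le (by norm_num), hμp, hβ,
          Real.rpow_neg (by norm_num)]
        ring
      have hS2 : ∑ k ∈ Sᶜ, (if k ∈ S then μ k / 2 else μ k) ^ a = T * Q := by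
        rw [hQ, Finset.mul_sum]
        refine Finset.sum_congr rfl fun k hk => ?_
        rw [if_neg (Finset.mem_compl.1 hk), hμp]
      rw [← Finset.sum_add_sum_compl S, ← hQ] at hpsum
      rw [hS1, hS2, hZ]
      linear_combination T * β * hpsum
    simp only [modeProb]
    rw [h1, if_neg (Finset.mem_compl.1 hl), hμp]
    field_simp
  have h1 : ∑ l ∈ Sᶜ, modeProb (fun l => if l ∈ S then μ l / 2 else μ l) a l = Q / Z := by
    rw [Finset.sum_congr rfl hprob, hQ, Finset.sum_div]
  have h2 : ∑ l ∈ Sᶜ, modeProb (fun l => if l ∈ S then μ l / 2 else μ l) a l *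
      (β * remaining p (insert l S) + (1 - β) * ((insert l S)ᶜ.card : ℝ)) =
      (β * ∑ l ∈ Sᶜ, p l * remaining p (insert l S) + (1 - β) * (Sᶜ.card - 1) * Q) / Z := by
    rw [hQ, Finset.mul_sum, Finset.mul_sum, ← Finset.sum_add_distrib, Finset.sum_div]
    refine Finset.sum_congr rfl fun l hl => ?_
    have : ((insert l S)ᶜ.card : ℝ) = Sᶜ.card - 1 := by
      rw [← card_compl_insert hl]; push_cast; ring
    rw [hprob l hl, this]
    ring
  have h3 := remaining_step hp0 hS
  rw [← hQ] at h3
  rw [h1, h2]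
  field_simp
  rw [hZ]
  linear_combination β * h3

end Remaining

theorem ofReal_discount {L : ℕ} {a W : ℝ} (ha : 0 < a) (hW : 0 ≤ W) :
    ENNReal.ofReal (2 ^ (-a) * W + (1 - 2 ^ (-a)) * L) =
      ENNReal.ofReal (2 ^ (-a)) * ENNReal.ofReal W + ENNReal.ofReal (1 - 2 ^ (-a)) * L := by
  have hβ1 : (2 : ℝ) ^ (-a) ≤ 1 :=
    Real.rpow_le_one_of_one_le_of_nonpos (by norm_num) (by linarith)
  have h1 := sub_nonneg.2 hβ1
  rw [ENNReal.ofReal_add (by positivity) (by positivity), ENNReal.ofReal_mul (by positivity),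
    ENNReal.ofReal_mul h1, ENNReal.ofReal_natCast]

/-- The bound by the sum of `1 / p l` suffices: `2^(-a) / p l` is the sum over `k` of `(μ k / (2 μ
l)) ^ a`, and all bases are below one. -/
theorem tendsto_discount_remaining {L : ℕ} {μ : Fin L → ℝ} (hμ : ∀ k, 0 < μ k)
    (hlt : ∀ k l, μ k < 2 * μ l) :
    Tendsto (fun a : ℝ => 2 ^ (-a) * remaining (modeProb μ a) ∅) atTop (𝓝 0) := by
  have hlim : Tendsto (fun a : ℝ => ∑ l, ∑ k, (μ k / (2 * μ l)) ^ a) atTop (𝓝 0) := by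
    have : Tendsto (fun a : ℝ => ∑ l, ∑ k, (μ k / (2 * μ l)) ^ a) atTop
        (𝓝 (∑ l : Fin L, ∑ k : Fin L, (0 : ℝ))) := by
      refine tendsto_finsetSum _ fun l _ => tendsto_finsetSum _ fun k _ => ?_
      have hk := hμ k
      have hl := hμ l
      have hpos : 0 < μ k / (2 * μ l) := by positivity
      exact tendsto_rpow_atTop_of_base_lt_one _ (by linarith)
        ((div_lt_one (by positivity)).2 (hlt k l))
    simpa using this
  refine squeeze_zero (fun a => mul_nonneg (by positivity)
    (remaining_nonneg (modeProb_pos hμ a) _)) (fun a => ?_) hlim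
  calc (2 : ℝ) ^ (-a) * remaining (modeProb μ a) ∅
      ≤ 2 ^ (-a) * ∑ l, 1 / modeProb μ a l :=
        mul_le_mul_of_nonneg_left (remaining_le_sum_inv (modeProb_pos hμ a)) (by positivity)
    _ = _ := by
      rw [Finset.mul_sum]
      refine Finset.sum_congr rfl fun l _ => ?_
      have hl := hμ l
      rw [modeProb, one_div_div, Finset.sum_div, Finset.mul_sum]
      refine Finset.sum_congr rfl fun k _ => ?_
      rw [Real.div_rpow (hμ k).le (by positivity), Real.mul_rpow (by norm_num) hl.le,
        Real.rpow_neg (by norm_num)]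
      field_simp

end MuonRebalance

end

/-! ### Assembly of the results -/

theorem mainTheorem6 {L d : ℕ} (hL : 0 < L) (ζ : MuonRebalance.Modes L d) (μ : Fin L → ℝ)
    (hμ_pos : ∀ l, 0 < μ l) (hμ_le : ∀ l, μ l ≤ 1) :
    (∀ a : ℝ, 1 < a →
      ∀ (Ω : Type*) [MeasurableSpace Ω] (P : Measure Ω) [IsProbabilityMeasure P]
        (α : ℕ → Fin L → Ω → ℝ), MuonRebalance.IsFrechetFamily a P α →
      ∀ w : ℕ → Ω → ℝ → MuonRebalance.Weight d,
        MuonRebalance.IsIndependentLearning ζ μ P α w →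
        -- independent feature learning
        (∀ j l, P {ω | Tendsto (w j ω) atTop (𝓝 (ζ l))} =
          ENNReal.ofReal (MuonRebalance.modeProb μ a l)) ∧
        MuonRebalance.expectedNodes ζ P w ≠ ∞ ∧
        ENNReal.ofReal (max (1 / ⨅ l, MuonRebalance.modeProb μ a l)
            (L * ∑ l ∈ Finset.Icc 1 L, 1 / (l : ℝ))) ≤ MuonRebalance.expectedNodes ζ P w ∧
        -- sequential learning with the Muon update
        (∀ v : ℕ → Ω → ℝ → MuonRebalance.Weight d,
          MuonRebalance.IsSequentialLearning ζ (MuonRebalance.muonRule ζ μ) P α v →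
          (L : ℝ≥0∞) ≤ MuonRebalance.expectedNodes ζ P v ∧
          MuonRebalance.expectedNodes ζ P v ≤
            ENNReal.ofReal (2 ^ (-a)) * MuonRebalance.expectedNodes ζ P w +
              ENNReal.ofReal (1 - 2 ^ (-a)) * L) ∧
        -- sequential learning, collected modes discounted by exactly one half
        (∀ u : ℕ → Ω → ℝ → MuonRebalance.Weight d,
          MuonRebalance.IsSequentialLearning ζ (MuonRebalance.halvingRule ζ μ) P α u →
          MuonRebalance.expectedNodes ζ P u =
            ENNReal.ofReal (2 ^ (-a)) * MuonRebalance.expectedNodes ζ P w +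
              ENNReal.ofReal (1 - 2 ^ (-a)) * L)) ∧
    -- large `a`
    (∀ ε : ℝ, 0 < ε → ∀ᶠ a : ℝ in atTop,
      ∀ (Ω : Type*) [MeasurableSpace Ω] (P : Measure Ω) [IsProbabilityMeasure P]
        (α : ℕ → Fin L → Ω → ℝ), MuonRebalance.IsFrechetFamily a P α →
        (∀ v : ℕ → Ω → ℝ → MuonRebalance.Weight d,
          MuonRebalance.IsSequentialLearning ζ (MuonRebalance.muonRule ζ μ) P α v →
          MuonRebalance.expectedNodes ζ P v ≤ L + ENNReal.ofReal ε) ∧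
        ((∀ k l, μ k < 2 * μ l) → ∀ u : ℕ → Ω → ℝ → MuonRebalance.Weight d,
          MuonRebalance.IsSequentialLearning ζ (MuonRebalance.halvingRule ζ μ) P α u →
          MuonRebalance.expectedNodes ζ P u ≤ L + ENNReal.ofReal ε)) := by
  constructor
  · intro a ha Ω _ P _ α hα w hw
    have ha0 : 0 < a := by linarith
    have hp := MuonRebalance.modeProb_pos hμ_pos a
    -- Independent learning is sequential learning whose weights ignore the collected set.
    have hT : MuonRebalance.expectedNodes ζ P w = ENNReal.ofReal
        (MuonRebalance.remaining (MuonRebalance.modeProb μ a) ∅) :=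
      MuonRebalance.expectedNodes_eq (m := fun _ => μ) hα ha0 hL (fun _ => hμ_pos) hw
        (MuonRebalance.isExpectedRemaining_const hL hμ_pos a)
    refine ⟨MuonRebalance.measure_tendsto_mode hα ha0 hL hμ_pos hw, ?_, ?_, fun v hv => ?_,
      fun u hu => ?_⟩
    · rw [hT]
      exact ENNReal.ofReal_ne_top
    · rw [hT]
      refine ENNReal.ofReal_le_ofReal (max_le ?_ ?_)
      · have : Nonempty (Fin L) := ⟨⟨0, hL⟩⟩
        obtain ⟨k, hk⟩ := exists_eq_ciInf_of_finite (f := MuonRebalance.modeProb μ a)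
        rw [← hk]
        exact MuonRebalance.inv_le_remaining hp k
      · exact MuonRebalance.harmonic_le_remaining hp (MuonRebalance.sum_modeProb hL hμ_pos a)
    · rw [MuonRebalance.expectedNodes_muon hα ha0 hμ_pos hμ_le hv]
      refine ⟨le_rfl, ?_⟩
      have hβ0 : (0 : ℝ) ≤ 2 ^ (-a) := by positivity
      have hβ1 : (2 : ℝ) ^ (-a) ≤ 1 :=
        Real.rpow_le_one_of_one_le_of_nonpos (by norm_num) (by linarith)
      calc (L : ℝ≥0∞) = (ENNReal.ofReal (2 ^ (-a)) + ENNReal.ofReal (1 - 2 ^ (-a))) * L := by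
            rw [← ENNReal.ofReal_add hβ0 (sub_nonneg.2 hβ1), add_sub_cancel, ENNReal.ofReal_one,
              one_mul]
        _ = ENNReal.ofReal (2 ^ (-a)) * L + ENNReal.ofReal (1 - 2 ^ (-a)) * L := add_mul _ _ _
        _ ≤ _ := by
            gcongr
            exact MuonRebalance.le_expectedNodes ζ w
    · have hU := MuonRebalance.expectedNodes_eq hα ha0 hL (fun S k => by
          have := hμ_pos k
          split_ifs <;> positivity) hu
        (MuonRebalance.isExpectedRemaining_half hL hμ_pos ha0)
      rw [hU, hT, ← MuonRebalance.ofReal_discount ha0 (MuonRebalance.remaining_nonneg hp _)]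
      simp
  · intro ε hε
    have hhalf : ∀ᶠ a : ℝ in atTop, (∀ k l, μ k < 2 * μ l) →
        2 ^ (-a) * MuonRebalance.remaining (MuonRebalance.modeProb μ a) ∅ < ε := by
      by_cases hlt : ∀ k l, μ k < 2 * μ l
      · filter_upwards [(MuonRebalance.tendsto_discount_remaining hμ_pos hlt).eventually
          (gt_mem_nhds hε)] with a ha _ using ha
      · exact Eventually.of_forall fun _ h => absurd h hlt
    filter_upwards [hhalf, eventually_gt_atTop 0] with a hhalf ha0 Ω _ P _ α hα
    refine ⟨fun v hv => ?_, fun hlt u hu => ?_⟩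
    · rw [MuonRebalance.expectedNodes_muon hα ha0 hμ_pos hμ_le hv]
      exact le_self_add
    · have hU := MuonRebalance.expectedNodes_eq hα ha0 hL (fun S k => by
          have := hμ_pos k
          split_ifs <;> positivity) hu
        (MuonRebalance.isExpectedRemaining_half hL hμ_pos ha0)
      rw [hU, add_comm (L : ℝ≥0∞), ← ENNReal.ofReal_natCast (n := L),
        ← ENNReal.ofReal_add hε.le (Nat.cast_nonneg L)]
      refine ENNReal.ofReal_le_ofReal (add_le_add (hhalf hlt).le ?_)
      have hβ0 : (0 : ℝ) < 2 ^ (-a) := by positivity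
      simp only [Finset.compl_empty, Finset.card_univ, Fintype.card_fin]
      exact mul_le_of_le_one_left (Nat.cast_nonneg L) (by linarith)
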